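/- For a real $3$-tensor $\mathcal A\in(\mathbb R^n)^{\otimes 3}$ let $\mathcal A(x)=\langle \mathcal A,x^{\otimes 3}\rangle=\sum_{i,j,k\in[n]}\mathcal A_{ijk}x_ix_jx_k$ and $f_{\max}(\mathcal A)=\sup_{\|x\|_2=1}\mathcal A(x)$. For even $q\ge 3$ let $\mathrm{SoS}_q(\mathcal A)$ be the supremum of $\widetilde{\mathbf E}[\mathcal A(x)]$ over all degree-$q$ pseudo-expectation operators respecting the constraint $\|x\|_2^q=1$, that is, over all linear functionals $\widetilde{\mathbf E}:\mathbb R[x_1,\dots,x_n]_{\le q}\to\mathbb R$ such that $\widetilde{\mathbf E}[1]=1$, $\widetilde{\mathbf E}[p^2]\ge 0$ for every polynomial $p$ of degree at most $q/2$, and $\widetilde{\mathbf E}[p\cdot(\|x\|_2^q-1)]=0$ for every polynomial $p$ with $\deg\big(p\cdot(\|x\|_2^q-1)\big)\le q$. Theorem. There are absolute constants $C>0$, $k\in\mathbb N$ and $c>0$ such that the following holds for all $n$ and all even $q$ with $3\le q\le n$. If $\mathcal A\in(\mathbb R^n)^{\otimes 3}$ is a random tensor with i.i.d. uniform $\pm1$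 entries, then with probability at least $1-n^{-c}$ we have $f_{\max}(\mathcal A)>0$ and $$\frac{\mathrm{SoS}_q(\mathcal A)}{f_{\max}(\mathcal A)}\ \le\ \left(\frac{C\,n\,(\log n)^k}{q}\right)^{1/4}.$$ -/

import Mathlib

open MeasureTheory ProbabilityTheory

/-- A real tensor of order `d` on `ℝⁿ`, given by its entries, which are indexed by `[n]^d`. -/
abbrev RealTensor (d n : ℕ) : Type := (Fin d → Fin n) → ℝ

/-- The homogeneous polynomial `𝒜(x) = ⟨𝒜, x^{⊗ d}⟩ = ∑_I 𝒜[I] · x_{I 1} ⋯ x_{I d}`. -/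
noncomputable def RealTensor.toPoly {d n : ℕ} (A : RealTensor d n) : MvPolynomial (Fin n) ℝ :=
  ∑ I : Fin d → Fin n, MvPolynomial.C (A I) * ∏ j : Fin d, MvPolynomial.X (I j)

/-- `f_max`: the supremum of a polynomial over the Euclidean unit sphere of `ℝⁿ`. -/
noncomputable def polyMax {n : ℕ} (f : MvPolynomial (Fin n) ℝ) : ℝ :=
  sSup {y : ℝ | ∃ x : EuclideanSpace ℝ (Fin n), ‖x‖ = 1 ∧ MvPolynomial.eval (fun i => x i) f = y}

/-- `ℝ[x]_{≤ q}`: the space of real polynomials in `n` variables of degree at most `q`. -/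
noncomputable abbrev PolyLE (n q : ℕ) : Submodule ℝ (MvPolynomial (Fin n) ℝ) :=
  MvPolynomial.restrictTotalDegree (Fin n) ℝ q

theorem PolyLE.one_mem (n q : ℕ) : (1 : MvPolynomial (Fin n) ℝ) ∈ PolyLE n q := by
  rw [MvPolynomial.mem_restrictTotalDegree]
  simp

theorem PolyLE.sq_mem {n q : ℕ} {p : MvPolynomial (Fin n) ℝ} (hp : p.totalDegree ≤ q / 2) :
    p ^ 2 ∈ PolyLE n q := by
  rw [MvPolynomial.mem_restrictTotalDegree]
  have h := MvPolynomial.totalDegree_pow p 2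
  omega

/-- A degree-`q` pseudo-expectation operator: a linear functional on polynomials of degree at most
`q` which is normalised and nonnegative on squares. -/
structure IsPseudoExpectation {n q : ℕ} (E : PolyLE n q →ₗ[ℝ] ℝ) : Prop where
  map_one : E ⟨1, PolyLE.one_mem n q⟩ = 1
  sq_nonneg : ∀ (p : MvPolynomial (Fin n) ℝ) (hp : p.totalDegree ≤ q / 2),
    0 ≤ E ⟨p ^ 2, PolyLE.sq_mem hp⟩

/-- The operator `E` respects the polynomial constraint `f = 0`: it vanishes on every multiple
`p * f` of degree at most `q`. -/
def RespectsEq {n q : ℕ} (E : PolyLE n q →ₗ[ℝ] ℝ) (f : MvPolynomial (Fin n) ℝ) : Prop :=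
  ∀ (p : MvPolynomial (Fin n) ℝ) (h : p * f ∈ PolyLE n q), E ⟨p * f, h⟩ = 0

/-- For even `q`, the polynomial `‖x‖₂^q - 1`. -/
noncomputable def sphereConstraint (n q : ℕ) : MvPolynomial (Fin n) ℝ :=
  (∑ i : Fin n, MvPolynomial.X i ^ 2) ^ (q / 2) - 1

/-- The value of the degree-`q` SoS relaxation of the maximum of `f` on the unit sphere (for
`deg f ≤ q`, `q` even): the supremum of `Ẽ[f]` over all degree-`q` pseudo-expectation operators
which respect `‖x‖₂^q = 1`. It lives in the extended reals, so that the supremum is a true one. -/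
noncomputable def sosValue {n : ℕ} (q : ℕ) (f : MvPolynomial (Fin n) ℝ) : EReal :=
  sSup {v : EReal | ∃ (E : PolyLE n q →ₗ[ℝ] ℝ) (hf : f ∈ PolyLE n q),
    IsPseudoExpectation E ∧ RespectsEq E (sphereConstraint n q) ∧ v = ((E ⟨f, hf⟩ : ℝ) : EReal)}

/-- A random tensor whose entries are independent, uniform `±1` random variables. -/
structure IsRademacherTensor {Ω : Type*} [MeasurableSpace Ω] (P : Measure Ω) {d n : ℕ}
    (A : Ω → RealTensor d n) : Prop where
  measurable_entry : ∀ I : Fin d → Fin n, Measurable fun ω => A ω I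
  indep : iIndepFun (fun (I : Fin d → Fin n) (ω : Ω) => A ω I) P
  prob_one : ∀ I : Fin d → Fin n, P {ω | A ω I = 1} = 1 / 2
  prob_neg_one : ∀ I : Fin d → Fin n, P {ω | A ω I = -1} = 1 / 2

/-! Write the cubic form as `∑ x_i Q_i` with `Q_i` the quadratic form of the `i`-th slice, and put
`u = ‖x‖²`, `N = q / 2`. The denominator is controlled for every sign tensor: `f_max ≥ √(n-1) / 3`
(`sqrt_le_three_mul_polyMax`). It remains to bound every pseudo-expectation of the cubic by `O(√(log
n) · n^{3/4} / q^{1/4})`. By Cauchy–Schwarz, in the form `Ẽ ∑ (c x_i - Q_i)² ≥ 0`, it is enough that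
`Ẽ ∑ Q_i² = O(log n · n^{3/2} / √q)`.

Lifting. Let the symmetrised slice `B_i` act on `(ℝⁿ)^{⊗ l}` as the sum of its actions on the
factors. At `x^{⊗ l}` the quadratic form of the square of this operator is `l(l-1) Q_i² u^{l-2} + l
|B_i x|² u^{l-1}`. The sum over `i`, centred at its mean, is `sliceOperator l`, which has norm
`O(log n · (nl)^{3/2})` with high probability. Division by `l(l-1)` gives a sum-of-squares proof of
`∑ Q_i² u^{l-2} ≤ O(log n · n^{3/2} / √l) u^l`; the term in `|B_i x|²` is absorbed by the operator
with `l = 1`, and the mean contributes only `n u^l` (`IsPseudoMoment.sum_quadForm_sq_mul_le`).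

Norm bound. The operator is a matrix Rademacher chaos of order two. Discrete integration by parts
bounds its trace moments by those of its discrete derivatives, whose squares sum to an operator
controlled by the chaos itself, so the recursion closes (`sum_trace_centredSquares_pow_le`). Moments
of order about `l log n`, Markov's inequality and a union bound over `l` finish.

Removing `u`. The constraint is only `‖x‖^q = 1`, which at degree `q` gives `Ẽ u^N = 1` and does not
allow `u` to be replaced by `1`. Instead, `1 = (u (1 - u/4) + (1 - u/2)²)^d` with `d` of order `q`
expands `∑ Q_i²` into terms carrying `u^k`, each certified at rate `1 / √(k+1)`. A Bernstein-type
estimate bounds the resulting polynomial in `u` by `O(1/√d) (1 + u^N)` on `[0, ∞)`. One-variable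
inequalities of this kind pass to pseudo-expectations, because a polynomial nonnegative on `[0, ∞)`
is `σ₀ + u σ₁` with sums of squares `σ₀`, `σ₁` (`IsPseudoMoment.le_of_forall_normSq_pow_mul_le`). -/

/-! ### Traces and quadratic forms of real symmetric matrices. -/

section SpectralCalculus

open Matrix

variable {T : Type*} [Fintype T] [DecidableEq T]

theorem Matrix.IsSymm.exists_orthogonal_diagonalization {W : Matrix T T ℝ} (hW : W.IsSymm) :
    ∃ (U : Matrix T T ℝ) (l : T → ℝ), Uᵀ * U = 1 ∧ U * Uᵀ = 1 ∧ W = U * diagonal l * Uᵀ := by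
  have hH : W.IsHermitian := by
    rw [Matrix.IsHermitian, Matrix.conjTranspose_eq_transpose_of_trivial]; exact hW
  refine ⟨hH.eigenvectorUnitary, hH.eigenvalues, ?_, ?_, ?_⟩
  · have := Unitary.coe_star_mul_self hH.eigenvectorUnitary
    rwa [Matrix.star_eq_conjTranspose, Matrix.conjTranspose_eq_transpose_of_trivial] at this
  · have := Unitary.coe_mul_star_self hH.eigenvectorUnitary
    rwa [Unitary.coe_star, Matrix.star_eq_conjTranspose, Matrix.conjTranspose_eq_transpose_of_trivial] at this
  · have := hH.spectral_theorem
    rw [Unitary.conjStarAlgAut_apply, Matrix.star_eq_conjTranspose,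
      Matrix.conjTranspose_eq_transpose_of_trivial] at this
    exact this

theorem Matrix.pow_of_orthogonal_diagonalization {U : Matrix T T ℝ} {l : T → ℝ}
    (h1 : Uᵀ * U = 1) (h2 : U * Uᵀ = 1) (k : ℕ) :
    (U * diagonal l * Uᵀ) ^ k = U * diagonal (fun t => l t ^ k) * Uᵀ := by
  induction k with
  | zero => simp [h2]
  | succ k ih =>
    rw [pow_succ, ih]
    calc U * diagonal (fun t => l t ^ k) * Uᵀ * (U * diagonal l * Uᵀ)
        = U * diagonal (fun t => l t ^ k) * (Uᵀ * U) * diagonal l * Uᵀ := by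
          simp only [Matrix.mul_assoc]
      _ = _ := by
          rw [h1, Matrix.mul_one, Matrix.mul_assoc U, diagonal_mul_diagonal]
          simp only [pow_succ]

theorem Matrix.trace_pow_of_orthogonal_diagonalization {U : Matrix T T ℝ} {l : T → ℝ}
    (h1 : Uᵀ * U = 1) (h2 : U * Uᵀ = 1) (k : ℕ) :
    ((U * diagonal l * Uᵀ) ^ k).trace = ∑ t, l t ^ k := by
  rw [Matrix.pow_of_orthogonal_diagonalization h1 h2, Matrix.trace_mul_comm, ← Matrix.mul_assoc, h1,
    Matrix.one_mul, Matrix.trace_diagonal]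

theorem Matrix.mulVec_dotProduct_of_orthogonal_diagonalization (U : Matrix T T ℝ) (l : T → ℝ)
    (v : T → ℝ) :
    ((U * diagonal l * Uᵀ) *ᵥ v) ⬝ᵥ v = ∑ t, l t * (Uᵀ *ᵥ v) t ^ 2 := by
  rw [← Matrix.mulVec_mulVec, ← Matrix.mulVec_mulVec, dotProduct_comm, Matrix.dotProduct_mulVec,
    ← Matrix.mulVec_transpose]
  simp only [dotProduct, Matrix.mulVec_diagonal]
  exact Finset.sum_congr rfl fun t _ => by ring

theorem Matrix.sum_sq_of_orthogonal {U : Matrix T T ℝ} (h2 : U * Uᵀ = 1) (v : T → ℝ) :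
    ∑ t, (Uᵀ *ᵥ v) t ^ 2 = v ⬝ᵥ v := by
  have : (Uᵀ *ᵥ v) ⬝ᵥ (Uᵀ *ᵥ v) = v ⬝ᵥ v := by
    rw [Matrix.dotProduct_mulVec, ← Matrix.mulVec_transpose, Matrix.transpose_transpose,
      Matrix.mulVec_mulVec, h2, Matrix.one_mulVec]
  rw [← this, dotProduct]
  exact Finset.sum_congr rfl fun t _ => by ring

/-- A symmetric matrix has a spectral radius `R`; it bounds the quadratic form, and its even powers
are bounded by traces. -/
theorem Matrix.IsSymm.exists_spectral_bound {K : Matrix T T ℝ} (hK : K.IsSymm) :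
    ∃ (l : T → ℝ) (R : ℝ), 0 ≤ R ∧ (∀ k, (K ^ k).trace = ∑ t, l t ^ k) ∧
      (∀ k, R ^ (2 * (k + 1)) ≤ (K ^ (2 * (k + 1))).trace) ∧ (∀ t, |l t| ≤ R) ∧
      ∀ v : T → ℝ, |(K *ᵥ v) ⬝ᵥ v| ≤ R * (v ⬝ᵥ v) := by
  obtain ⟨U, l, h1, h2, rfl⟩ := hK.exists_orthogonal_diagonalization
  have htr := fun k => Matrix.trace_pow_of_orthogonal_diagonalization (l := l) h1 h2 k
  obtain ⟨R, hR0, hRl, hRm⟩ : ∃ R : ℝ, 0 ≤ R ∧ (∀ t, |l t| ≤ R) ∧ (R = 0 ∨ ∃ t, R = |l t|) := by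
    rcases isEmpty_or_nonempty T with hT | hT
    · exact ⟨0, le_rfl, fun t => hT.elim t, Or.inl rfl⟩
    · obtain ⟨t, ht⟩ := Finite.exists_max fun t => |l t|
      exact ⟨|l t|, abs_nonneg _, ht, Or.inr ⟨t, rfl⟩⟩
  refine ⟨l, R, hR0, htr, fun k => ?_, hRl, fun v => ?_⟩
  · rw [htr]
    have hpos : ∀ t, 0 ≤ l t ^ (2 * (k + 1)) := fun t => by rw [pow_mul]; positivity
    rcases hRm with h | ⟨t, h⟩
    · rw [h, zero_pow (by omega)]; exact Finset.sum_nonneg fun t _ => hpos t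
    · rw [h, pow_mul, sq_abs, ← pow_mul]
      exact Finset.single_le_sum (f := fun t => l t ^ (2 * (k + 1))) (fun t _ => hpos t)
        (Finset.mem_univ t)
  · rw [Matrix.mulVec_dotProduct_of_orthogonal_diagonalization, ← Matrix.sum_sq_of_orthogonal h2,
      Finset.mul_sum]
    refine (Finset.abs_sum_le_sum_abs _ _).trans (Finset.sum_le_sum fun t _ => ?_)
    rw [abs_mul, abs_of_nonneg (sq_nonneg ((Uᵀ *ᵥ v) t))]
    exact mul_le_mul_of_nonneg_right (hRl t) (sq_nonneg _)

theorem pow_mul_pow_le_add (a b : ℝ) {r s m : ℕ} (h : r + s = 2 * m) :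
    a ^ r * b ^ s ≤ a ^ (2 * m) + b ^ (2 * m) := by
  have hA : a ^ (2 * m) = |a| ^ (2 * m) := by rw [pow_mul, pow_mul, sq_abs]
  have hB : b ^ (2 * m) = |b| ^ (2 * m) := by rw [pow_mul, pow_mul, sq_abs]
  rw [hA, hB]
  refine (le_abs_self _).trans ?_
  rw [abs_mul, abs_pow, abs_pow]
  rcases le_total |a| |b| with hab | hab
  · calc |a| ^ r * |b| ^ s ≤ |b| ^ r * |b| ^ s := by gcongr
      _ = |b| ^ (2 * m) := by rw [← pow_add, h]
      _ ≤ _ := le_add_of_nonneg_left (by positivity)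
  · calc |a| ^ r * |b| ^ s ≤ |a| ^ r * |a| ^ s := by gcongr
      _ = |a| ^ (2 * m) := by rw [← pow_add, h]
      _ ≤ _ := le_add_of_nonneg_right (by positivity)

/-- In eigenbases `U` of `W` and `V` of `Z` the trace is `∑ (UᵀHV)_{tt'}² λ_t^r κ_{t'}^s`, with
nonnegative weights, so the scalar inequality applies term by term although `W` and `Z` need not
commute. -/
theorem Matrix.trace_mul_pow_mul_mul_pow_le {H W Z : Matrix T T ℝ} (hH : H.IsSymm) (hW : W.IsSymm)
    (hZ : Z.IsSymm) {r s m : ℕ} (h : r + s = 2 * m) :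
    (H * W ^ r * H * Z ^ s).trace ≤
      (H * H * W ^ (2 * m)).trace + (H * H * Z ^ (2 * m)).trace := by
  obtain ⟨U, l, hU1, hU2, rfl⟩ := hW.exists_orthogonal_diagonalization
  obtain ⟨V, k, hV1, hV2, rfl⟩ := hZ.exists_orthogonal_diagonalization
  have key : ∀ r s : ℕ, (H * (U * diagonal l * Uᵀ) ^ r * H * (V * diagonal k * Vᵀ) ^ s).trace
      = ∑ t, ∑ t', (Uᵀ * H * V) t t' ^ 2 * (l t ^ r * k t' ^ s) := by
    intro r s
    rw [Matrix.pow_of_orthogonal_diagonalization hU1 hU2,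
      Matrix.pow_of_orthogonal_diagonalization hV1 hV2]
    have : H * (U * diagonal (fun t => l t ^ r) * Uᵀ) * H * (V * diagonal (fun t => k t ^ s) * Vᵀ)
      = (H * U) * (diagonal (fun t => l t ^ r) * (Uᵀ * H * V) * diagonal (fun t => k t ^ s) * Vᵀ)
        := by simp only [Matrix.mul_assoc]
    rw [this, Matrix.trace_mul_comm, Matrix.mul_assoc]
    have h3 : Vᵀ * (H * U) = (Uᵀ * H * V)ᵀ := by
      rw [Matrix.transpose_mul, Matrix.transpose_mul, Matrix.transpose_transpose, hH.eq]
    rw [h3]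
    simp only [Matrix.trace, Matrix.diag, Matrix.mul_apply (M := _ * diagonal _),
      Matrix.mul_diagonal, Matrix.diagonal_mul, Matrix.transpose_apply]
    exact Finset.sum_congr rfl fun t _ => Finset.sum_congr rfl fun t' _ => by ring
  have k1 := key (2 * m) 0
  have k2 := key 0 (2 * m)
  rw [pow_zero, Matrix.mul_one] at k1
  rw [pow_zero, Matrix.mul_one] at k2
  have k3 : (H * H * (U * diagonal l * Uᵀ) ^ (2 * m)).trace
      = (H * (U * diagonal l * Uᵀ) ^ (2 * m) * H).trace := by
    rw [Matrix.mul_assoc, Matrix.trace_mul_comm]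
  rw [k3, k1, k2, key, ← Finset.sum_add_distrib]
  refine Finset.sum_le_sum fun t _ => ?_
  rw [← Finset.sum_add_distrib]
  refine Finset.sum_le_sum fun t' _ => ?_
  rw [pow_zero, pow_zero, mul_one, one_mul, ← mul_add]
  exact mul_le_mul_of_nonneg_left (pow_mul_pow_le_add _ _ h) (sq_nonneg _)

theorem pow_sub_pow_eq_sum {R : Type*} [Ring R] (W Z : R) (k : ℕ) :
    W ^ k - Z ^ k = ∑ r ∈ Finset.range k, W ^ r * (W - Z) * Z ^ (k - 1 - r) := by
  induction k with
  | zero => simp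
  | succ k ih =>
    rw [Finset.sum_range_succ]
    have : ∑ r ∈ Finset.range k, W ^ r * (W - Z) * Z ^ (k + 1 - 1 - r)
        = (∑ r ∈ Finset.range k, W ^ r * (W - Z) * Z ^ (k - 1 - r)) * Z := by
      rw [Finset.sum_mul]
      refine Finset.sum_congr rfl fun r hr => ?_
      have hr' := Finset.mem_range.1 hr
      rw [mul_assoc _ _ Z, ← pow_succ]
      congr 2; omega
    rw [this, ← ih]
    simp only [Nat.add_sub_cancel, Nat.sub_self, pow_zero, mul_one]
    rw [pow_succ, pow_succ]
    noncomm_ring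

omit [DecidableEq T] in
theorem Matrix.trace_transpose_mul_self_eq (X : Matrix T T ℝ) :
    (Xᵀ * X).trace = ∑ t, X.col t ⬝ᵥ X.col t := by
  simp [Matrix.trace, Matrix.mul_apply, dotProduct, Matrix.col]

/-- The hypothesis is the operator inequality `∑ D_a² ≤ ν`; pairing it with the positive
semidefinite `K^{2m}` amounts to testing it on the columns of `K^m`. -/
theorem Matrix.sum_trace_mul_pow_le {α : Type*} [Fintype α] {K : Matrix T T ℝ} (hK : K.IsSymm)
    (D : α → Matrix T T ℝ) (hD : ∀ a, (D a).IsSymm) {ν : ℝ}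
    (h : ∀ v : T → ℝ, ∑ a, (D a *ᵥ v) ⬝ᵥ (D a *ᵥ v) ≤ ν * (v ⬝ᵥ v)) (m : ℕ) :
    ∑ a, (D a * D a * K ^ (2 * m)).trace ≤ ν * (K ^ (2 * m)).trace := by
  have hKm : (K ^ m)ᵀ = K ^ m := by rw [Matrix.transpose_pow, hK.eq]
  have e1 : ∀ a, (D a * D a * K ^ (2 * m)).trace
      = ∑ t, (D a *ᵥ (K ^ m).col t) ⬝ᵥ (D a *ᵥ (K ^ m).col t) := by
    intro a
    have : (D a * D a * K ^ (2 * m)).trace = ((D a * K ^ m)ᵀ * (D a * K ^ m)).trace := by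
      rw [Matrix.transpose_mul, hKm, (hD a).eq, two_mul, pow_add, ← Matrix.mul_assoc,
        Matrix.trace_mul_comm]
      simp only [Matrix.mul_assoc]
    rw [this, Matrix.trace_transpose_mul_self_eq]
    rfl
  have e2 : (K ^ (2 * m)).trace = ∑ t, (K ^ m).col t ⬝ᵥ (K ^ m).col t := by
    rw [← Matrix.trace_transpose_mul_self_eq, hKm, two_mul, pow_add]
  simp only [e1, e2]
  rw [Finset.sum_comm, Finset.mul_sum]
  exact Finset.sum_le_sum fun t _ => h _

end SpectralCalculus

/-! ### Discrete integration by parts for a matrix chaos of order two. -/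

section RademacherChaos

open Matrix

/-- The real value `±1` of a sign. -/
def signVal (s : ℤˣ) : ℝ := ((s : ℤ) : ℝ)

theorem signVal_mul_self (s : ℤˣ) : signVal s * signVal s = 1 := by
  rcases Int.units_eq_one_or s with rfl | rfl <;> simp [signVal]

theorem signVal_neg (s : ℤˣ) : signVal (-s) = -signVal s := by simp [signVal]

/-- Reverse the sign at one coordinate. -/
def flipSign {α : Type*} [DecidableEq α] (a : α) (e : α → ℤˣ) : α → ℤˣ :=
  Function.update e a (-e a)

theorem flipSign_flipSign {α : Type*} [DecidableEq α] (a : α) (e : α → ℤˣ) :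
    flipSign a (flipSign a e) = e := by
  simp [flipSign]

theorem sum_flipSign {α β : Type*} [Fintype α] [DecidableEq α] [AddCommMonoid β] (a : α)
    (f : (α → ℤˣ) → β) : ∑ e, f (flipSign a e) = ∑ e, f e :=
  Equiv.sum_comp (Function.Involutive.toPerm (flipSign a) (flipSign_flipSign a)) f

variable {T ι M : Type*} [Fintype T] [DecidableEq T] [Fintype ι] [DecidableEq ι] [Fintype M]
  [DecidableEq M]

/-- The `i`-th signed sum `G_i = ∑_m ε_{im} E_m`. -/
def signedSum {V : Type*} [AddCommGroup V] [Module ℝ V] (E : M → V) (e : ι × M → ℤˣ) (i : ι) : V :=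
  ∑ m, signVal (e (i, m)) • E m

/-- The centred sum of squares `∑_i G_i² - 𝔼 ∑_i G_i²`. -/
def centredSquares (E : M → Matrix T T ℝ) (e : ι × M → ℤˣ) : Matrix T T ℝ :=
  ∑ i, signedSum E e i * signedSum E e i - (Fintype.card ι : ℝ) • ∑ m, E m * E m

/-- The discrete derivative of `centredSquares` in the coordinate `a`. -/
def squaresDeriv (E : M → Matrix T T ℝ) (e : ι × M → ℤˣ) (a : ι × M) : Matrix T T ℝ :=
  signVal (e a) • (signedSum E e a.1 * E a.2 + E a.2 * signedSum E e a.1)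
    - (2 : ℝ) • (E a.2 * E a.2)

omit [Fintype ι] in
theorem signedSum_flipSign {V : Type*} [AddCommGroup V] [Module ℝ V] (E : M → V)
    (e : ι × M → ℤˣ) (a : ι × M) (i : ι) :
    signedSum E (flipSign a e) i =
      signedSum E e i - if i = a.1 then (2 * signVal (e a)) • E a.2 else 0 := by
  unfold signedSum
  rw [eq_sub_iff_add_eq]
  split_ifs with h
  · subst h
    rw [← Finset.sum_erase_add _ _ (Finset.mem_univ a.2),
      ← Finset.sum_erase_add Finset.univ (fun m => signVal (e (a.1, m)) • E m)
        (Finset.mem_univ a.2), add_assoc]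
    congr 1
    · refine Finset.sum_congr rfl fun m hm => ?_
      have : (a.1, m) ≠ a := fun h => (Finset.ne_of_mem_erase hm) (by rw [← h])
      simp [flipSign, Function.update_of_ne this]
    · simp only [flipSign, Function.update_self, Prod.mk.eta, signVal_neg]
      module
  · rw [add_zero]
    refine Finset.sum_congr rfl fun m _ => ?_
    have : (i, m) ≠ a := fun h' => h (by rw [← h'])
    simp [flipSign, Function.update_of_ne this]

theorem centredSquares_sub_flipSign (E : M → Matrix T T ℝ) (e : ι × M → ℤˣ) (a : ι × M) :
    centredSquares E e - centredSquares E (flipSign a e) = (2 : ℝ) • squaresDeriv E e a := by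
  unfold centredSquares squaresDeriv
  simp only [signedSum_flipSign]
  rw [sub_sub_sub_cancel_right, ← Finset.sum_sub_distrib, Finset.sum_eq_single a.1]
  · simp only [if_true]
    set G := signedSum E e a.1
    set s := signVal (e a) with hs
    have h : s * s = 1 := signVal_mul_self _
    simp only [sub_mul, mul_sub, smul_mul_assoc, mul_smul_comm, smul_add, smul_sub, smul_smul]
    have : 2 * s * (2 * s) = 2 * 2 := by linear_combination 4 * h
    rw [this]
    module
  · intro i _ hi
    simp [hi]
  · simp

/-- Antisymmetry under the flip plays the role of the zero mean of the increment in integration by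
parts. -/
theorem squaresDeriv_flipSign (E : M → Matrix T T ℝ) (e : ι × M → ℤˣ) (a : ι × M) :
    squaresDeriv E (flipSign a e) a = -squaresDeriv E e a := by
  have h1 := centredSquares_sub_flipSign E e a
  have h2 := centredSquares_sub_flipSign E (flipSign a e) a
  rw [flipSign_flipSign] at h2
  have : (2 : ℝ) • squaresDeriv E (flipSign a e) a = (2 : ℝ) • -squaresDeriv E e a := by
    rw [smul_neg, ← h1, ← h2]; abel
  exact smul_right_injective _ (two_ne_zero) this

-- Euler's identity for a form of degree two in the signs: centring removes exactly the diagonal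
-- terms, and what is left is homogeneous.
omit [DecidableEq ι] [DecidableEq M] in
theorem sum_squaresDeriv (E : M → Matrix T T ℝ) (e : ι × M → ℤˣ) :
    ∑ a, squaresDeriv E e a = (2 : ℝ) • centredSquares E e := by
  rw [Fintype.sum_prod_type]
  have : ∀ i, ∑ m, squaresDeriv E e (i, m)
      = (2 : ℝ) • (signedSum E e i * signedSum E e i) - (2 : ℝ) • ∑ m, E m * E m := by
    intro i
    simp only [squaresDeriv]
    rw [Finset.sum_sub_distrib, ← Finset.smul_sum]
    congr 1
    have h1 : ∑ m, signVal (e (i, m)) • E m = signedSum E e i := rfl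
    have h2 : ∀ m, signVal (e (i, m)) • (signedSum E e i * E m + E m * signedSum E e i)
        = signedSum E e i * signVal (e (i, m)) • E m
          + signVal (e (i, m)) • E m * signedSum E e i := fun m => by
      rw [smul_add, mul_smul_comm, smul_mul_assoc]
    simp only [h2]
    rw [Finset.sum_add_distrib, ← Finset.mul_sum, ← Finset.sum_mul, h1, two_smul]
  simp only [this]
  rw [Finset.sum_sub_distrib, centredSquares, smul_sub, Finset.smul_sum, Finset.sum_const,
    Finset.card_univ, ← Nat.cast_smul_eq_nsmul ℝ, smul_comm]
  simp only [Finset.smul_sum]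

omit [Fintype ι] [DecidableEq ι] [DecidableEq M] [Fintype T] [DecidableEq T] in
theorem signedSum_isSymm {E : M → Matrix T T ℝ} (hE : ∀ m, (E m).IsSymm) (e : ι × M → ℤˣ) (i : ι) :
    (signedSum E e i).IsSymm := by
  unfold signedSum
  rw [Matrix.IsSymm, Matrix.transpose_sum]
  exact Finset.sum_congr rfl fun m _ => by rw [Matrix.transpose_smul, (hE m).eq]

omit [DecidableEq ι] [DecidableEq M] [DecidableEq T] in
theorem centredSquares_isSymm {E : M → Matrix T T ℝ} (hE : ∀ m, (E m).IsSymm) (e : ι × M → ℤˣ) :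
    (centredSquares E e).IsSymm := by
  unfold centredSquares
  rw [Matrix.IsSymm, Matrix.transpose_sub, Matrix.transpose_smul, Matrix.transpose_sum,
    Matrix.transpose_sum]
  simp only [Matrix.transpose_mul, (hE _).eq, (signedSum_isSymm hE e _).eq]

omit [Fintype ι] [DecidableEq ι] [DecidableEq M] [DecidableEq T] in
theorem squaresDeriv_isSymm {E : M → Matrix T T ℝ} (hE : ∀ m, (E m).IsSymm) (e : ι × M → ℤˣ)
    (a : ι × M) : (squaresDeriv E e a).IsSymm := by
  unfold squaresDeriv
  rw [Matrix.IsSymm, Matrix.transpose_sub, Matrix.transpose_smul, Matrix.transpose_smul,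
    Matrix.transpose_add]
  simp only [Matrix.transpose_mul, (hE _).eq, (signedSum_isSymm hE e _).eq]
  rw [add_comm]

/-- Integration by parts for even trace moments of `centredSquares`. -/
theorem sum_trace_pow_le_sum_trace_deriv {E : M → Matrix T T ℝ} (hE : ∀ m, (E m).IsSymm) (m : ℕ) :
    ∑ e : ι × M → ℤˣ, (centredSquares E e ^ (2 * (m + 1))).trace ≤
      (2 * m + 1) * ∑ e : ι × M → ℤˣ,
        ∑ a, (squaresDeriv E e a * squaresDeriv E e a * centredSquares E e ^ (2 * m)).trace := by
  set K : (ι × M → ℤˣ) → Matrix T T ℝ := fun e => centredSquares E e with hK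
  set D : (ι × M → ℤˣ) → ι × M → Matrix T T ℝ := fun e a => squaresDeriv E e a with hD
  have step1 : 2 * ∑ e, (K e ^ (2 * (m + 1))).trace
      = ∑ a, ∑ e, (D e a * K e ^ (2 * m + 1)).trace := by
    rw [Finset.mul_sum, Finset.sum_comm]
    refine Finset.sum_congr rfl fun e _ => ?_
    rw [← Matrix.trace_sum, ← Finset.sum_mul, sum_squaresDeriv, smul_mul_assoc, Matrix.trace_smul,
      ← pow_succ', smul_eq_mul]
    rfl
  -- Averaging over `e` and its flip replaces `K^{2m+1}` by half of `K^{2m+1} - K'^{2m+1}`. This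
  -- telescopes into `2m+1` terms `K^r (2D) K'^{2m-r}`, and the trace inequality separates `K` from
  -- its flip `K'`.
  have step2 : ∀ a, ∑ e, (D e a * K e ^ (2 * m + 1)).trace ≤
      2 * ((2 * m + 1) * ∑ e, (D e a * D e a * K e ^ (2 * m)).trace) := by
    intro a
    have h1 : ∑ e, (D e a * K (flipSign a e) ^ (2 * m + 1)).trace
        = -∑ e, (D e a * K e ^ (2 * m + 1)).trace := by
      rw [← sum_flipSign a, ← Finset.sum_neg_distrib]
      refine Finset.sum_congr rfl fun e _ => ?_
      rw [flipSign_flipSign, hD]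
      simp only [squaresDeriv_flipSign, neg_mul, Matrix.trace_neg]
    have h2 : 2 * ∑ e, (D e a * K e ^ (2 * m + 1)).trace
        = ∑ e, (D e a * (K e ^ (2 * m + 1) - K (flipSign a e) ^ (2 * m + 1))).trace := by
      simp only [mul_sub, Matrix.trace_sub, Finset.sum_sub_distrib]
      rw [h1]; ring
    have h3 : ∀ e, (D e a * (K e ^ (2 * m + 1) - K (flipSign a e) ^ (2 * m + 1))).trace
        ≤ 2 * ((2 * m + 1) * ((D e a * D e a * K e ^ (2 * m)).trace
          + (D e a * D e a * K (flipSign a e) ^ (2 * m)).trace)) := by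
      intro e
      rw [pow_sub_pow_eq_sum, Finset.mul_sum, Matrix.trace_sum]
      have hb : ∀ r ∈ Finset.range (2 * m + 1),
          (D e a * (K e ^ r * (K e - K (flipSign a e)) * K (flipSign a e) ^ (2 * m + 1 - 1 - r))).trace
          ≤ 2 * ((D e a * D e a * K e ^ (2 * m)).trace
          + (D e a * D e a * K (flipSign a e) ^ (2 * m)).trace) := by
        intro r hr
        have hr' := Finset.mem_range.1 hr
        have : D e a * (K e ^ r * (K e - K (flipSign a e)) * K (flipSign a e) ^ (2 * m + 1 - 1 - r))
          = (2 : ℝ) • (D e a * K e ^ r * D e a * K (flipSign a e) ^ (2 * m - r)) := by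
          rw [hK]
          simp only [centredSquares_sub_flipSign]
          simp only [smul_mul_assoc, mul_smul_comm, Matrix.mul_assoc, Nat.add_sub_cancel]
          rfl
        rw [this, Matrix.trace_smul, smul_eq_mul]
        refine mul_le_mul_of_nonneg_left ?_ zero_le_two
        exact Matrix.trace_mul_pow_mul_mul_pow_le (squaresDeriv_isSymm hE e a)
          (centredSquares_isSymm hE _) (centredSquares_isSymm hE _) (by omega)
      refine (Finset.sum_le_sum hb).trans (le_of_eq ?_)
      rw [Finset.sum_const, Finset.card_range, nsmul_eq_mul]
      push_cast; ring
    have h4 : ∑ e, (D e a * D e a * K (flipSign a e) ^ (2 * m)).trace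
        = ∑ e, (D e a * D e a * K e ^ (2 * m)).trace := by
      rw [← sum_flipSign a]
      refine Finset.sum_congr rfl fun e _ => ?_
      rw [flipSign_flipSign, hD]
      simp only [squaresDeriv_flipSign, neg_mul_neg]
    have h5 := Finset.sum_le_sum fun e (_ : e ∈ Finset.univ) => h3 e
    rw [← h2, ← Finset.mul_sum, ← Finset.mul_sum, Finset.sum_add_distrib, h4] at h5
    linarith
  have step3 := Finset.sum_le_sum fun a (_ : a ∈ Finset.univ) => step2 a
  rw [← step1, ← Finset.mul_sum, ← Finset.mul_sum, Finset.sum_comm] at step3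
  exact le_of_mul_le_mul_left step3 two_pos

end RademacherChaos

/-! ### Trace moments and tails of the centred sum of squares. -/

section MomentBound

open Matrix

variable {T ι M : Type*} [Fintype T] [DecidableEq T] [Fintype ι] [DecidableEq ι] [Fintype M]
  [DecidableEq M]

omit [DecidableEq T] in
theorem Matrix.IsSymm.mul_self_mulVec_dotProduct {A : Matrix T T ℝ} (hA : A.IsSymm) (v : T → ℝ) :
    ((A * A) *ᵥ v) ⬝ᵥ v = (A *ᵥ v) ⬝ᵥ (A *ᵥ v) := by
  rw [← Matrix.mulVec_mulVec, dotProduct_comm, Matrix.dotProduct_mulVec, ← Matrix.mulVec_transpose,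
    hA.eq]

omit [DecidableEq T] in
theorem Matrix.sum_mulVec_dotProduct {α : Type*} (s : Finset α) (A : α → Matrix T T ℝ)
    (v w : T → ℝ) : ((∑ i ∈ s, A i) *ᵥ v) ⬝ᵥ w = ∑ i ∈ s, (A i *ᵥ v) ⬝ᵥ w := by
  rw [Matrix.sum_mulVec, sum_dotProduct]

-- Each derivative is `±(G E + E G) - 2E²`. Since `∑ G_i²` is the chaos plus its mean, it is at most
-- `R + nσ`; hence the squares of the derivatives are controlled by the chaos itself. With `|x + y -
-- 2z|² ≤ 3(|x|² + |y|² + 4|z|²)` the total is `3 (2σ(R + nσ) + 4nσ²)`.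
omit [DecidableEq T] [DecidableEq ι] [DecidableEq M] in
theorem sum_dotProduct_squaresDeriv_le {E : M → Matrix T T ℝ} (hE : ∀ m, (E m).IsSymm) {σ R : ℝ}
    (hσ0 : 0 ≤ σ) (hσ : ∀ v : T → ℝ, ∑ m, (E m *ᵥ v) ⬝ᵥ (E m *ᵥ v) ≤ σ * (v ⬝ᵥ v))
    (e : ι × M → ℤˣ) (hR0 : 0 ≤ R)
    (hR : ∀ v : T → ℝ, |(centredSquares E e *ᵥ v) ⬝ᵥ v| ≤ R * (v ⬝ᵥ v)) (v : T → ℝ) :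
    ∑ a, (squaresDeriv E e a *ᵥ v) ⬝ᵥ (squaresDeriv E e a *ᵥ v) ≤
      (6 * σ * R + 18 * Fintype.card ι * σ ^ 2) * (v ⬝ᵥ v) := by
  set G := signedSum E e with hG
  have hnn : ∀ w : T → ℝ, 0 ≤ w ⬝ᵥ w := fun w => Finset.sum_nonneg fun t _ => mul_self_nonneg _
  have hGs : ∀ i, (G i).IsSymm := signedSum_isSymm hE e
  set n : ℝ := (Fintype.card ι : ℝ) with hn
  have hn0 : 0 ≤ n := by positivity
  have hY : ∀ w : T → ℝ, ∑ i, (G i *ᵥ w) ⬝ᵥ (G i *ᵥ w) ≤ (R + n * σ) * (w ⬝ᵥ w) := by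
    intro w
    have h1 : (centredSquares E e *ᵥ w) ⬝ᵥ w = ∑ i, (G i *ᵥ w) ⬝ᵥ (G i *ᵥ w)
        - n * ∑ m, (E m *ᵥ w) ⬝ᵥ (E m *ᵥ w) := by
      unfold centredSquares
      rw [Matrix.sub_mulVec, sub_dotProduct, Matrix.smul_mulVec, smul_dotProduct,
        Matrix.sum_mulVec_dotProduct, Matrix.sum_mulVec_dotProduct]
      simp only [(hE _).mul_self_mulVec_dotProduct, (hGs _).mul_self_mulVec_dotProduct, smul_eq_mul,
        ← hG]
      rfl
    have h2 := (le_abs_self _).trans (hR w)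
    have h3 := mul_le_mul_of_nonneg_left (hσ w) hn0
    rw [h1] at h2
    linarith
  have hpt : ∀ i m, (squaresDeriv E e (i, m) *ᵥ v) ⬝ᵥ (squaresDeriv E e (i, m) *ᵥ v) ≤
      3 * ((G i *ᵥ (E m *ᵥ v)) ⬝ᵥ (G i *ᵥ (E m *ᵥ v)) + (E m *ᵥ (G i *ᵥ v)) ⬝ᵥ (E m *ᵥ (G i *ᵥ v))
        + 4 * ((E m *ᵥ (E m *ᵥ v)) ⬝ᵥ (E m *ᵥ (E m *ᵥ v)))) := by
    intro i m
    have h1 : squaresDeriv E e (i, m) *ᵥ v = signVal (e (i, m)) • (G i *ᵥ (E m *ᵥ v)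
        + E m *ᵥ (G i *ᵥ v)) - (2 : ℝ) • (E m *ᵥ (E m *ᵥ v)) := by
      unfold squaresDeriv
      rw [Matrix.sub_mulVec, Matrix.smul_mulVec, Matrix.smul_mulVec, Matrix.add_mulVec]
      simp only [Matrix.mulVec_mulVec]
      rfl
    rw [h1]
    generalize G i *ᵥ (E m *ᵥ v) = x
    generalize E m *ᵥ (G i *ᵥ v) = y
    generalize E m *ᵥ (E m *ᵥ v) = z
    simp only [dotProduct]
    rw [Finset.mul_sum, ← Finset.sum_add_distrib, ← Finset.sum_add_distrib, Finset.mul_sum]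
    refine Finset.sum_le_sum fun t _ => ?_
    simp only [Pi.sub_apply, Pi.smul_apply, Pi.add_apply, smul_eq_mul]
    have hs := signVal_mul_self (e (i, m))
    set s := signVal (e (i, m))
    have : (s * (x t + y t) - 2 * z t) * (s * (x t + y t) - 2 * z t)
      = (s * s) * (x t + y t) ^ 2 - 4 * (s * x t) * z t - 4 * (s * y t) * z t + 4 * z t ^ 2 := by
      ring
    rw [this, hs]
    have e1 : (s * x t) ^ 2 = x t ^ 2 := by rw [mul_pow, sq, hs, one_mul]
    have e2 : (s * y t) ^ 2 = y t ^ 2 := by rw [mul_pow, sq, hs, one_mul]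
    nlinarith [sq_nonneg (s * x t + 2 * z t), sq_nonneg (s * y t + 2 * z t),
      sq_nonneg (x t - y t)]
  rw [Fintype.sum_prod_type]
  have b1 : ∑ m, ∑ i, (G i *ᵥ (E m *ᵥ v)) ⬝ᵥ (G i *ᵥ (E m *ᵥ v)) ≤
      (R + n * σ) * (σ * (v ⬝ᵥ v)) := by
    refine (Finset.sum_le_sum fun m _ => hY (E m *ᵥ v)).trans ?_
    rw [← Finset.mul_sum]
    exact mul_le_mul_of_nonneg_left (hσ v) (by positivity)
  have b2 : ∑ i, ∑ m, (E m *ᵥ (G i *ᵥ v)) ⬝ᵥ (E m *ᵥ (G i *ᵥ v)) ≤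
      σ * ((R + n * σ) * (v ⬝ᵥ v)) := by
    refine (Finset.sum_le_sum fun i _ => hσ (G i *ᵥ v)).trans ?_
    rw [← Finset.mul_sum]
    exact mul_le_mul_of_nonneg_left (hY v) hσ0
  have b3 : ∑ m, (E m *ᵥ (E m *ᵥ v)) ⬝ᵥ (E m *ᵥ (E m *ᵥ v)) ≤ σ * (σ * (v ⬝ᵥ v)) := by
    have : ∀ m, (E m *ᵥ (E m *ᵥ v)) ⬝ᵥ (E m *ᵥ (E m *ᵥ v)) ≤ σ * ((E m *ᵥ v) ⬝ᵥ (E m *ᵥ v)) :=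
      fun m => (Finset.single_le_sum
        (f := fun k => (E k *ᵥ (E m *ᵥ v)) ⬝ᵥ (E k *ᵥ (E m *ᵥ v))) (fun k _ => hnn _)
        (Finset.mem_univ m)).trans (hσ _)
    refine (Finset.sum_le_sum fun m _ => this m).trans ?_
    rw [← Finset.mul_sum]
    exact mul_le_mul_of_nonneg_left (hσ v) hσ0
  have b4 : ∑ _i : ι, ∑ m, 4 * ((E m *ᵥ (E m *ᵥ v)) ⬝ᵥ (E m *ᵥ (E m *ᵥ v))) ≤
      n * (4 * (σ * (σ * (v ⬝ᵥ v)))) := by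
    rw [Finset.sum_const, Finset.card_univ, nsmul_eq_mul, ← Finset.mul_sum]
    gcongr
  rw [Finset.sum_comm] at b1
  refine (Finset.sum_le_sum fun i _ => Finset.sum_le_sum fun m _ => hpt i m).trans ?_
  simp only [← Finset.mul_sum, Finset.sum_add_distrib] at b4 ⊢
  nlinarith

theorem mul_mul_pow_le_add (a b c : ℝ) (hb : 0 ≤ b) (hc : 0 ≤ c) (m : ℕ) :
    b * c * a ^ (2 * m) ≤ b ^ (2 * (m + 1)) + c ^ (2 * (m + 1)) + a ^ (2 * (m + 1)) := by
  have hA : ∀ k, a ^ (2 * k) = |a| ^ (2 * k) := fun k => by rw [pow_mul, pow_mul, sq_abs]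
  rw [hA, hA]
  set d := max b (max c |a|) with hd
  have h1 : b ≤ d := le_max_left _ _
  have h2 : c ≤ d := (le_max_left _ _).trans (le_max_right _ _)
  have h3 : |a| ≤ d := (le_max_right _ _).trans (le_max_right _ _)
  calc b * c * |a| ^ (2 * m) ≤ d * d * d ^ (2 * m) := by gcongr
    _ = d ^ (2 * (m + 1)) := by ring
    _ ≤ _ := by
      have p1 : 0 ≤ b ^ (2 * (m + 1)) := by positivity
      have p2 : 0 ≤ c ^ (2 * (m + 1)) := by positivity
      have p3 : 0 ≤ |a| ^ (2 * (m + 1)) := by positivity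
      rcases max_choice b (max c |a|) with h | h
      · rw [hd, h]; linarith
      · rcases max_choice c |a| with h' | h' <;> rw [hd, h, h'] <;> linarith

/-- The even trace moments of a centred sum of squares of Rademacher series with symmetric matrix
coefficients. -/
theorem sum_trace_centredSquares_pow_le {E : M → Matrix T T ℝ} (hE : ∀ m, (E m).IsSymm) {σ τ : ℝ}
    (hσ0 : 0 ≤ σ) (hσ : ∀ v : T → ℝ, ∑ m, (E m *ᵥ v) ⬝ᵥ (E m *ᵥ v) ≤ σ * (v ⬝ᵥ v)) (m : ℕ)
    (hT : (Fintype.card T : ℝ) ≤ 4 ^ (m + 1)) (hτ0 : 0 ≤ τ) (hτ1 : 192 * (m + 1) * σ ≤ τ)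
    (hτ2 : 144 * (m + 1) * Fintype.card ι * σ ^ 2 ≤ τ ^ 2) :
    ∑ e : ι × M → ℤˣ, (centredSquares E e ^ (2 * (m + 1))).trace ≤
      Fintype.card (ι × M → ℤˣ) * (Fintype.card T * τ ^ (2 * (m + 1))) := by
  set n : ℝ := (Fintype.card ι : ℝ) with hn
  set d : ℝ := (Fintype.card T : ℝ) with hd
  have key : ∀ e : ι × M → ℤˣ, (2 * m + 1) * ∑ a,
      (squaresDeriv E e a * squaresDeriv E e a * centredSquares E e ^ (2 * m)).trace ≤
      1 / 2 * (centredSquares E e ^ (2 * (m + 1))).trace + 3 / 8 * (d * τ ^ (2 * (m + 1))) := by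
    intro e
    have hK := centredSquares_isSymm hE e
    obtain ⟨l, R, hR0, htr, hRtr, hRl, hRv⟩ := hK.exists_spectral_bound
    have h1 := Matrix.sum_trace_mul_pow_le hK (squaresDeriv E e) (squaresDeriv_isSymm hE e)
      (sum_dotProduct_squaresDeriv_le hE hσ0 hσ e hR0 hRv) m
    have hR := hRtr m
    rw [htr] at h1 hR
    rw [htr]
    have hpos : ∀ k, 0 ≤ ∑ t, l t ^ (2 * k) := fun k =>
      Finset.sum_nonneg fun t _ => by rw [pow_mul]; positivity
    -- The constants in `hτ1` and `hτ2` are `192 = 16 · 12` and `144 = 4 · 36`, since `6(2m+1) ≤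
    -- 12(m+1)` and `18(2m+1) ≤ 36(m+1)`. The radius is written as `R / 2` so that its power can
    -- beat the dimension in `c3`.
    have c1 : (2 * m + 1) * (6 * σ * R + 18 * n * σ ^ 2) ≤ 1 / 8 * (τ * (R / 2)) + 1 / 4 * τ ^ 2 := by
      have := mul_le_mul_of_nonneg_right hτ1 hR0
      have hm : (0 : ℝ) ≤ m := by positivity
      have p1 : 0 ≤ σ * R := by positivity
      have p2 : 0 ≤ n * σ ^ 2 := by positivity
      nlinarith
    have c2 : ∀ t, (1 / 8 * (τ * (R / 2)) + 1 / 4 * τ ^ 2) * l t ^ (2 * m) ≤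
        3 / 8 * l t ^ (2 * (m + 1)) + 3 / 8 * τ ^ (2 * (m + 1))
          + 1 / 8 * (R / 2) ^ (2 * (m + 1)) := by
      intro t
      have k1 := mul_mul_pow_le_add (l t) τ (R / 2) hτ0 (by positivity) m
      have k2 : τ ^ 2 * l t ^ (2 * m) ≤ τ ^ (2 * (m + 1)) + l t ^ (2 * (m + 1)) := by
        exact pow_mul_pow_le_add τ (l t) (r := 2) (s := 2 * m) (m := m + 1) (by ring)
      linarith
    -- The moment order is large enough for `4^{m+1}` to exceed the dimension. The random radius is
    -- then bounded by the trace moment, which is absorbed on the left.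
    have c3 : d * (R / 2) ^ (2 * (m + 1)) ≤ R ^ (2 * (m + 1)) := by
      rw [div_pow, pow_mul (2 : ℝ)]
      norm_num only
      rw [mul_div_assoc', div_le_iff₀ (by positivity), mul_comm]
      exact mul_le_mul_of_nonneg_left hT (by positivity)
    calc (2 * m + 1) * ∑ a, (squaresDeriv E e a * squaresDeriv E e a
          * centredSquares E e ^ (2 * m)).trace
        ≤ (2 * m + 1) * ((6 * σ * R + 18 * n * σ ^ 2) * ∑ t, l t ^ (2 * m)) := by gcongr
      _ = ((2 * m + 1) * (6 * σ * R + 18 * n * σ ^ 2)) * ∑ t, l t ^ (2 * m) := by ring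
      _ ≤ (1 / 8 * (τ * (R / 2)) + 1 / 4 * τ ^ 2) * ∑ t, l t ^ (2 * m) :=
          mul_le_mul_of_nonneg_right c1 (hpos m)
      _ ≤ ∑ t, (3 / 8 * l t ^ (2 * (m + 1)) + 3 / 8 * τ ^ (2 * (m + 1))
          + 1 / 8 * (R / 2) ^ (2 * (m + 1))) := by
          rw [Finset.mul_sum]; exact Finset.sum_le_sum fun t _ => c2 t
      _ = 3 / 8 * ∑ t, l t ^ (2 * (m + 1)) + 3 / 8 * (d * τ ^ (2 * (m + 1)))
          + 1 / 8 * (d * (R / 2) ^ (2 * (m + 1))) := by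
          simp only [Finset.sum_add_distrib, Finset.sum_const, Finset.card_univ, nsmul_eq_mul,
            ← Finset.mul_sum, ← hd]
          ring
      _ ≤ _ := by linarith
  have h1 := sum_trace_pow_le_sum_trace_deriv (ι := ι) hE m
  rw [Finset.mul_sum] at h1
  have h2 := h1.trans (Finset.sum_le_sum fun e _ => key e)
  rw [Finset.sum_add_distrib, ← Finset.mul_sum, Finset.sum_const, Finset.card_univ,
    nsmul_eq_mul] at h2
  have h3 : 0 ≤ (Fintype.card (ι × M → ℤˣ) : ℝ) * (d * τ ^ (2 * (m + 1))) := by positivity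
  linarith

/-- The proportion of sign patterns for which the quadratic form of a centred sum of squares is
large somewhere. -/
theorem card_not_abs_centredSquares_le {E : M → Matrix T T ℝ} (hE : ∀ m, (E m).IsSymm) {σ τ : ℝ}
    (hσ0 : 0 ≤ σ) (hσ : ∀ v : T → ℝ, ∑ m, (E m *ᵥ v) ⬝ᵥ (E m *ᵥ v) ≤ σ * (v ⬝ᵥ v)) (m : ℕ)
    (hT : (Fintype.card T : ℝ) ≤ 4 ^ (m + 1)) (hτ0 : 0 < τ) (hτ1 : 192 * (m + 1) * σ ≤ τ)
    (hτ2 : 144 * (m + 1) * Fintype.card ι * σ ^ 2 ≤ τ ^ 2) (S : Finset (ι × M → ℤˣ))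
    (hS : ∀ e ∈ S, ¬ ∀ v : T → ℝ, |(centredSquares E e *ᵥ v) ⬝ᵥ v| ≤ 4 * τ * (v ⬝ᵥ v)) :
    (S.card : ℝ) * 4 ^ (m + 1) ≤ Fintype.card (ι × M → ℤˣ) := by
  have h1 := sum_trace_centredSquares_pow_le (ι := ι) hE hσ0 hσ m hT hτ0.le hτ1 hτ2
  have hbig : ∀ e ∈ S, (4 * τ) ^ (2 * (m + 1)) ≤ (centredSquares E e ^ (2 * (m + 1))).trace := by
    intro e he
    obtain ⟨l, R, hR0, htr, hRtr, hRl, hRv⟩ := (centredSquares_isSymm hE e).exists_spectral_bound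
    refine le_trans ?_ (hRtr m)
    have : 4 * τ ≤ R := by
      by_contra! hlt
      refine hS e he fun v => (hRv v).trans ?_
      exact mul_le_mul_of_nonneg_right hlt.le (Finset.sum_nonneg fun t _ => mul_self_nonneg _)
    gcongr
  have hpos : ∀ e : ι × M → ℤˣ, 0 ≤ (centredSquares E e ^ (2 * (m + 1))).trace := by
    intro e
    obtain ⟨l, R, hR0, htr, hRtr, hRl, hRv⟩ := (centredSquares_isSymm hE e).exists_spectral_bound
    exact le_trans (by positivity) (hRtr m)
  have h2 : (S.card : ℝ) * (4 * τ) ^ (2 * (m + 1)) ≤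
      Fintype.card (ι × M → ℤˣ) * (Fintype.card T * τ ^ (2 * (m + 1))) := by
    refine le_trans ?_ h1
    rw [← nsmul_eq_mul]
    refine (Finset.card_nsmul_le_sum S _ _ hbig).trans ?_
    exact Finset.sum_le_sum_of_subset_of_nonneg (Finset.subset_univ _) fun e _ _ => hpos e
  -- Markov's inequality at level `4τ` gains `16^{m+1}`; one factor `4^{m+1}` pays for the dimension
  -- and the other is the tail bound.
  rw [mul_pow, pow_mul (4 : ℝ), show ((4 : ℝ) ^ 2) = 4 * 4 by norm_num, mul_pow] at h2
  have hτ : 0 < τ ^ (2 * (m + 1)) := by positivity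
  have h3 : ((S.card : ℝ) * 4 ^ (m + 1)) * (4 ^ (m + 1) * τ ^ (2 * (m + 1))) ≤
      Fintype.card (ι × M → ℤˣ) * (4 ^ (m + 1) * τ ^ (2 * (m + 1))) := by
    calc _ = (S.card : ℝ) * (4 ^ (m + 1) * 4 ^ (m + 1) * τ ^ (2 * (m + 1))) := by ring
      _ ≤ _ := h2
      _ ≤ _ := by gcongr
  exact le_of_mul_le_mul_right h3 (by positivity)

end MomentBound

/-! ### The action of a matrix on a tensor power by summing over the factors. -/

section TensorLift

open Matrix

variable {n l : ℕ}

/-- The operator on `(ℝⁿ)^{⊗ l}` which is the sum of the actions of `B` on the `l` tensor factors. -/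
def tensorLift (l : ℕ) (B : Matrix (Fin n) (Fin n) ℝ) :
    Matrix (Fin l → Fin n) (Fin l → Fin n) ℝ :=
  fun t t' => ∑ s, if ∀ r, r ≠ s → t r = t' r then B (t s) (t' s) else 0

theorem sum_ite_forall_ne {β : Type*} [AddCommMonoid β] (t : Fin l → Fin n) (s : Fin l)
    (F : (Fin l → Fin n) → β) :
    ∑ t', (if ∀ r, r ≠ s → t r = t' r then F t' else 0) = ∑ k, F (Function.update t s k) := by
  rw [← Finset.sum_filter]
  symm
  refine Finset.sum_nbij' (fun k => Function.update t s k) (fun t' => t' s) ?_ ?_ ?_ ?_ ?_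
  · intro k _
    simp only [Finset.mem_filter, Finset.mem_univ, true_and]
    intro r hr
    rw [Function.update_of_ne hr]
  · simp
  · simp
  · intro t' ht'
    simp only [Finset.mem_filter, Finset.mem_univ, true_and] at ht'
    ext r
    by_cases h : r = s
    · subst h; simp
    · rw [Function.update_of_ne h, ht' r h]
  · simp

theorem sum_tensorLift_smul {V : Type*} [AddCommGroup V] [Module ℝ V]
    (B : Matrix (Fin n) (Fin n) ℝ) (v : (Fin l → Fin n) → V) (t : Fin l → Fin n) :
    ∑ t', tensorLift l B t t' • v t' =
      ∑ s, ∑ k, B (t s) k • v (Function.update t s k) := by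
  simp only [tensorLift, Finset.sum_smul, ite_smul, zero_smul]
  rw [Finset.sum_comm]
  refine Finset.sum_congr rfl fun s _ => ?_
  rw [sum_ite_forall_ne t s fun t' => B (t s) (t' s) • v t']
  simp

theorem tensorLift_mulVec (B : Matrix (Fin n) (Fin n) ℝ) (v : (Fin l → Fin n) → ℝ)
    (t : Fin l → Fin n) :
    (tensorLift l B *ᵥ v) t = ∑ s, ∑ k, B (t s) k * v (Function.update t s k) :=
  sum_tensorLift_smul B v t

theorem tensorLift_isSymm {B : Matrix (Fin n) (Fin n) ℝ} (hB : B.IsSymm) :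
    (tensorLift l B).IsSymm := by
  ext t t'
  simp only [Matrix.transpose_apply, tensorLift]
  refine Finset.sum_congr rfl fun s _ => ?_
  rw [hB.apply]
  simp only [eq_comm]

theorem tensorLift_sum_smul {M : Type*} (S : Finset M) (c : M → ℝ)
    (B : M → Matrix (Fin n) (Fin n) ℝ) :
    tensorLift l (∑ m ∈ S, c m • B m) = ∑ m ∈ S, c m • tensorLift l (B m) := by
  ext t t'
  simp only [Matrix.sum_apply, Matrix.smul_apply, tensorLift, Finset.smul_sum]
  rw [Finset.sum_comm]
  refine Finset.sum_congr rfl fun s _ => ?_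
  split_ifs <;> simp

/-- The symmetrised matrix unit `(e_j e_kᵀ + e_k e_jᵀ) / 2`. -/
noncomputable def symUnit (p : Fin n × Fin n) : Matrix (Fin n) (Fin n) ℝ :=
  (1 / 2 : ℝ) • (Matrix.single p.1 p.2 1 + Matrix.single p.2 p.1 1)

theorem symUnit_isSymm (p : Fin n × Fin n) : (symUnit p).IsSymm := by
  rw [Matrix.IsSymm, symUnit, Matrix.transpose_smul, Matrix.transpose_add,
    Matrix.transpose_single, Matrix.transpose_single, add_comm]

/-- Exchanging the entry `t s` with the free index `k` is an involution of the pairs `(t, k)`. -/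
theorem sum_update_comm {β : Type*} [AddCommMonoid β] (s : Fin l)
    (f : (Fin l → Fin n) → Fin n → β) :
    ∑ t : Fin l → Fin n, ∑ k, f (Function.update t s k) (t s) = ∑ t, ∑ k, f t k := by
  rw [← Fintype.sum_prod_type', ← Fintype.sum_prod_type']
  let φ : (Fin l → Fin n) × Fin n → (Fin l → Fin n) × Fin n :=
    fun p => (Function.update p.1 s p.2, p.1 s)
  have hφ : Function.Involutive φ := fun p => by simp [φ]
  exact Equiv.sum_comp hφ.toPerm fun p => f p.1 p.2

theorem sum_update_mul_update_le (v : (Fin l → Fin n) → ℝ) (s s' : Fin l) :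
    ∑ t : Fin l → Fin n, ∑ k, (if t s = t s' then
        v (Function.update t s k) * v (Function.update t s' k) else 0) ≤
      (if s = s' then (n : ℝ) else 1) * (v ⬝ᵥ v) := by
  have hone : ∀ a b : Fin l, ∑ t : Fin l → Fin n, ∑ k, (if t a = t b then
      v (Function.update t a k) ^ 2 else 0) = (if a = b then (n : ℝ) else 1) * (v ⬝ᵥ v) := by
    intro a b
    split_ifs with hab
    · subst hab
      simp only [if_true]
      rw [sum_update_comm a fun t _ => v t ^ 2]
      simp only [Finset.sum_const, Finset.card_univ, Fintype.card_fin, nsmul_eq_mul]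
      rw [← Finset.mul_sum]
      simp only [dotProduct, sq]
    · have h1 : ∀ (t : Fin l → Fin n) k, (if t a = t b then v (Function.update t a k) ^ 2 else 0)
          = (fun (t' : Fin l → Fin n) j => if j = t' b then v t' ^ 2 else 0)
            (Function.update t a k) (t a) := by
        intro t k
        simp only [Function.update_of_ne (Ne.symm hab)]
      simp only [h1]
      rw [sum_update_comm a fun (t' : Fin l → Fin n) j => if j = t' b then v t' ^ 2 else 0]
      simp [dotProduct, sq]
  have h2 := hone s s'
  have h3 := hone s' s
  have h4 : (if s' = s then (n : ℝ) else 1) = if s = s' then (n : ℝ) else 1 := by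
    simp only [eq_comm]
  rw [h4] at h3
  calc _ ≤ ∑ t : Fin l → Fin n, ∑ k,
        (1 / 2 * (if t s = t s' then v (Function.update t s k) ^ 2 else 0)
          + 1 / 2 * (if t s' = t s then v (Function.update t s' k) ^ 2 else 0)) := by
        refine Finset.sum_le_sum fun t _ => Finset.sum_le_sum fun k _ => ?_
        simp only [eq_comm (a := t s')]
        split_ifs
        · nlinarith [sq_nonneg (v (Function.update t s k) - v (Function.update t s' k))]
        · simp
    _ = _ := by
        simp only [Finset.sum_add_distrib, ← Finset.mul_sum]
        rw [h2, h3]; ring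

/-- Expanding the square gives pairs of factors `(s, s')`. The `l` diagonal pairs contribute `n`
each, since the row index is free. In the others the condition `t s = t s'` fixes an index, so each
contributes only `1`. -/
theorem sum_tensorLift_single_le (v : (Fin l → Fin n) → ℝ) :
    ∑ j, ∑ k, (tensorLift l (Matrix.single j k (1 : ℝ)) *ᵥ v) ⬝ᵥ
      (tensorLift l (Matrix.single j k (1 : ℝ)) *ᵥ v) ≤ (n * l + l ^ 2 : ℝ) * (v ⬝ᵥ v) := by
  have hnn : 0 ≤ v ⬝ᵥ v := Finset.sum_nonneg fun t _ => mul_self_nonneg _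
  have h1 : ∀ (j k : Fin n) (t : Fin l → Fin n),
      (tensorLift l (Matrix.single j k (1 : ℝ)) *ᵥ v) t
        = ∑ s, if j = t s then v (Function.update t s k) else 0 := by
    intro j k t
    rw [tensorLift_mulVec]
    refine Finset.sum_congr rfl fun s _ => ?_
    rw [Finset.sum_eq_single k]
    · by_cases h : j = t s <;> simp [h]
    · intro b _ hb
      simp [hb.symm]
    · simp
  have h2 : ∑ j, ∑ k, (tensorLift l (Matrix.single j k (1 : ℝ)) *ᵥ v) ⬝ᵥ
      (tensorLift l (Matrix.single j k (1 : ℝ)) *ᵥ v)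
      = ∑ s, ∑ s', ∑ t : Fin l → Fin n, ∑ k, (if t s = t s' then
        v (Function.update t s k) * v (Function.update t s' k) else 0) := by
    simp only [dotProduct, h1, Finset.sum_mul_sum]
    calc _ = ∑ k, ∑ t : Fin l → Fin n, ∑ s, ∑ s', ∑ j,
          (if j = t s then v (Function.update t s k) else 0) *
            (if j = t s' then v (Function.update t s' k) else 0) := by
          rw [Finset.sum_comm]
          refine Finset.sum_congr rfl fun k _ => ?_
          rw [Finset.sum_comm]
          refine Finset.sum_congr rfl fun t _ => ?_
          rw [Finset.sum_comm]
          refine Finset.sum_congr rfl fun s _ => ?_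
          rw [Finset.sum_comm]
      _ = ∑ k, ∑ t : Fin l → Fin n, ∑ s, ∑ s', (if t s = t s' then
        v (Function.update t s k) * v (Function.update t s' k) else 0) := by
          refine Finset.sum_congr rfl fun k _ => Finset.sum_congr rfl fun t _ =>
            Finset.sum_congr rfl fun s _ => Finset.sum_congr rfl fun s' _ => ?_
          simp only [ite_mul, zero_mul, Finset.sum_ite_eq', Finset.mem_univ, if_true, mul_ite,
            mul_zero, eq_comm]
      _ = _ := by
          rw [Finset.sum_comm]
          simp only [Finset.sum_comm (s := (Finset.univ : Finset (Fin n)))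
            (t := (Finset.univ : Finset (Fin l)))]
          rw [Finset.sum_comm]
          refine Finset.sum_congr rfl fun s _ => ?_
          rw [Finset.sum_comm]
  rw [h2]
  refine (Finset.sum_le_sum fun s _ => Finset.sum_le_sum fun s' _ =>
    sum_update_mul_update_le v s s').trans ?_
  simp only [← Finset.sum_mul]
  refine mul_le_mul_of_nonneg_right ?_ hnn
  calc ∑ s : Fin l, ∑ s' : Fin l, (if s = s' then (n : ℝ) else 1)
      ≤ ∑ s : Fin l, ∑ s' : Fin l, ((if s = s' then (n : ℝ) else 0) + 1) := by
        refine Finset.sum_le_sum fun s _ => Finset.sum_le_sum fun s' _ => ?_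
        split_ifs <;> simp
    _ = n * l + l ^ 2 := by
        simp [Finset.sum_add_distrib]; ring

theorem sum_tensorLift_symUnit_le (v : (Fin l → Fin n) → ℝ) :
    ∑ p, (tensorLift l (symUnit p) *ᵥ v) ⬝ᵥ (tensorLift l (symUnit p) *ᵥ v) ≤
      (n * l + l ^ 2 : ℝ) * (v ⬝ᵥ v) := by
  set D : Fin n → Fin n → (Fin l → Fin n) → ℝ :=
    fun j k => tensorLift l (Matrix.single j k (1 : ℝ)) *ᵥ v with hD
  have h1 : ∀ p : Fin n × Fin n, tensorLift l (symUnit p) *ᵥ v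
      = (1 / 2 : ℝ) • (D p.1 p.2 + D p.2 p.1) := by
    intro p
    have : tensorLift l (symUnit p) = (1 / 2 : ℝ) • (tensorLift l (Matrix.single p.1 p.2 1)
        + tensorLift l (Matrix.single p.2 p.1 1)) := by
      ext t t'
      simp only [symUnit, tensorLift, Matrix.smul_apply, Matrix.add_apply, smul_eq_mul]
      rw [← Finset.sum_add_distrib, Finset.mul_sum]
      refine Finset.sum_congr rfl fun s _ => ?_
      split_ifs <;> simp
    rw [this, Matrix.smul_mulVec, Matrix.add_mulVec]
  have h2 : ∀ p : Fin n × Fin n,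
      (tensorLift l (symUnit p) *ᵥ v) ⬝ᵥ (tensorLift l (symUnit p) *ᵥ v) ≤
        1 / 2 * (D p.1 p.2 ⬝ᵥ D p.1 p.2) + 1 / 2 * (D p.2 p.1 ⬝ᵥ D p.2 p.1) := by
    intro p
    rw [h1]
    generalize D p.1 p.2 = x
    generalize D p.2 p.1 = y
    simp only [dotProduct, Finset.mul_sum]
    rw [← Finset.sum_add_distrib]
    refine Finset.sum_le_sum fun t _ => ?_
    simp only [Pi.smul_apply, Pi.add_apply, smul_eq_mul]
    nlinarith [sq_nonneg (x t - y t)]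
  refine (Finset.sum_le_sum fun p _ => h2 p).trans ?_
  rw [Finset.sum_add_distrib, ← Finset.mul_sum, ← Finset.mul_sum, Fintype.sum_prod_type,
    Fintype.sum_prod_type, Finset.sum_comm (f := fun x y => D (x, y).2 (x, y).1 ⬝ᵥ _)]
  have := sum_tensorLift_single_le v
  simp only [hD]
  linarith

end TensorLift

/-! ### Quadratic forms evaluated at `x^{⊗ l}`. -/

section TensorForm

variable {n l : ℕ} {R : Type*} [CommRing R] [Algebra ℝ R]

/-- The monomial `∏ x_{t s}`, a coordinate of `x^{⊗ l}`. -/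
def tensorMonomial (x : Fin n → R) (t : Fin l → Fin n) : R := ∏ s, x (t s)

/-- The value at `x^{⊗ l}` of the quadratic form of a matrix on `(ℝⁿ)^{⊗ l}`. -/
def tensorForm (M : Matrix (Fin l → Fin n) (Fin l → Fin n) ℝ) (x : Fin n → R) : R :=
  ∑ t, ∑ t', M t t' • (tensorMonomial x t * tensorMonomial x t')

theorem tensorForm_mul_self {D : Matrix (Fin l → Fin n) (Fin l → Fin n) ℝ} (hD : D.IsSymm)
    (x : Fin n → R) :
    tensorForm (D * D) x = ∑ t, (∑ t', D t t' • tensorMonomial x t') ^ 2 := by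
  unfold tensorForm
  simp only [sq, Finset.sum_mul_sum, Matrix.mul_apply, Finset.sum_smul]
  calc _ = ∑ t', ∑ a, ∑ t, (D t a * D a t') • (tensorMonomial x t * tensorMonomial x t') := by
        rw [Finset.sum_comm]
        refine Finset.sum_congr rfl fun t' _ => ?_
        rw [Finset.sum_comm]
    _ = ∑ a, ∑ t', ∑ t, (D t a * D a t') • (tensorMonomial x t * tensorMonomial x t') := by
        rw [Finset.sum_comm]
    _ = _ := by
        refine Finset.sum_congr rfl fun a _ => ?_
        rw [Finset.sum_comm]
        refine Finset.sum_congr rfl fun t _ => Finset.sum_congr rfl fun t' _ => ?_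
        rw [smul_mul_smul_comm, hD.apply]

theorem tensorForm_sub (M M' : Matrix (Fin l → Fin n) (Fin l → Fin n) ℝ) (x : Fin n → R) :
    tensorForm (M - M') x = tensorForm M x - tensorForm M' x := by
  simp [tensorForm, sub_smul, Finset.sum_sub_distrib]

theorem tensorForm_smul (c : ℝ) (M : Matrix (Fin l → Fin n) (Fin l → Fin n) ℝ) (x : Fin n → R) :
    tensorForm (c • M) x = c • tensorForm M x := by
  simp [tensorForm, Finset.smul_sum, mul_smul]

theorem tensorForm_sum {α : Type*} (S : Finset α)
    (M : α → Matrix (Fin l → Fin n) (Fin l → Fin n) ℝ) (x : Fin n → R) :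
    tensorForm (∑ a ∈ S, M a) x = ∑ a ∈ S, tensorForm (M a) x := by
  unfold tensorForm
  simp only [Matrix.sum_apply, Finset.sum_smul]
  rw [Finset.sum_comm (s := S)]
  refine Finset.sum_congr rfl fun t _ => ?_
  rw [Finset.sum_comm]

omit [Algebra ℝ R] in
theorem sum_tensor_product (f : Fin l → Fin n → R) :
    ∑ t : Fin l → Fin n, ∏ r, f r (t r) = ∏ r, ∑ j, f r j :=
  (Fintype.prod_sum f).symm

theorem tensorForm_one (x : Fin n → R) :
    tensorForm (1 : Matrix (Fin l → Fin n) (Fin l → Fin n) ℝ) x = (∑ i, x i ^ 2) ^ l := by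
  unfold tensorForm
  simp only [Matrix.one_apply, ite_smul, one_smul, zero_smul, Finset.sum_ite_eq, Finset.mem_univ,
    if_true, tensorMonomial, ← Finset.prod_mul_distrib, ← sq]
  rw [sum_tensor_product fun _ j => x j ^ 2, Finset.prod_const, Finset.card_univ,
    Fintype.card_fin]

/-- The lift sends `x^{⊗ l}` to the sum over `s` of the product tensor with `Bx` in place `s`. Two
of these pair to `(xᵀBx)² u^{l-2}` if the places differ and to `|Bx|² u^{l-1}` if they agree. The
truncated exponents are harmless: their coefficients vanish when `l` is too small. -/
theorem tensorForm_tensorLift_mul_self {B : Matrix (Fin n) (Fin n) ℝ} (hB : B.IsSymm)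
    (x : Fin n → R) :
    tensorForm (tensorLift l B * tensorLift l B) x =
      ((l * (l - 1) : ℕ) : R) * ((∑ j, x j * ∑ k, B j k • x k) ^ 2 * (∑ i, x i ^ 2) ^ (l - 2))
        + (l : R) * ((∑ j, (∑ k, B j k • x k) ^ 2) * (∑ i, x i ^ 2) ^ (l - 1)) := by
  rw [tensorForm_mul_self (tensorLift_isSymm hB)]
  set y : Fin n → R := fun j => ∑ k, B j k • x k with hy
  have h1 : ∀ t : Fin l → Fin n, ∑ t', tensorLift l B t t' • tensorMonomial x t'
      = ∑ s, ∏ r, (if r = s then y (t r) else x (t r)) := by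
    intro t
    rw [sum_tensorLift_smul]
    refine Finset.sum_congr rfl fun s _ => ?_
    rw [← Finset.mul_prod_erase _ _ (Finset.mem_univ s), if_pos rfl, hy, Finset.sum_mul]
    refine Finset.sum_congr rfl fun k _ => ?_
    rw [smul_mul_assoc, tensorMonomial, ← Finset.mul_prod_erase _ _ (Finset.mem_univ s),
      Function.update_self]
    congr 2
    refine Finset.prod_congr rfl fun r hr => ?_
    have := Finset.ne_of_mem_erase hr
    rw [Function.update_of_ne this, if_neg this]
  simp only [h1, sq (∑ s, ∏ r, _), Finset.sum_mul_sum, ← Finset.prod_mul_distrib]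
  rw [Finset.sum_comm]
  simp only [Finset.sum_comm (s := (Finset.univ : Finset (Fin l → Fin n)))]
  have h2 : ∀ s s' : Fin l, ∑ t : Fin l → Fin n, ∏ r, ((if r = s then y (t r) else x (t r))
      * (if r = s' then y (t r) else x (t r)))
      = if s = s' then (∑ j, y j ^ 2) * (∑ i, x i ^ 2) ^ (l - 1)
        else (∑ j, x j * y j) ^ 2 * (∑ i, x i ^ 2) ^ (l - 2) := by
    intro s s'
    rw [sum_tensor_product fun r j => (if r = s then y j else x j) * (if r = s' then y j else x j)]
    split_ifs with h
    · subst h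
      rw [← Finset.mul_prod_erase _ _ (Finset.mem_univ s)]
      simp only [if_true, ← sq]
      congr 1
      rw [Finset.prod_congr rfl (g := fun _ => ∑ i, x i ^ 2), Finset.prod_const,
        Finset.card_erase_of_mem (Finset.mem_univ s), Finset.card_univ, Fintype.card_fin]
      intro r hr
      simp [Finset.ne_of_mem_erase hr]
    · have hs' : s' ∈ Finset.univ.erase s := Finset.mem_erase.2 ⟨Ne.symm h, Finset.mem_univ _⟩
      rw [← Finset.mul_prod_erase _ _ (Finset.mem_univ s), ← Finset.mul_prod_erase _ _ hs',
        ← mul_assoc, sq (∑ j, x j * y j)]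
      congr 1
      · simp only [if_true, if_neg h, if_neg (Ne.symm h)]
        congr 1
        exact Finset.sum_congr rfl fun j _ => mul_comm _ _
      · rw [Finset.prod_congr rfl (g := fun _ => ∑ i, x i ^ 2), Finset.prod_const,
          Finset.card_erase_of_mem hs', Finset.card_erase_of_mem (Finset.mem_univ s),
          Finset.card_univ, Fintype.card_fin, Nat.sub_sub]
        intro r hr
        have h3 := Finset.ne_of_mem_erase hr
        have h4 := Finset.ne_of_mem_erase (Finset.mem_of_mem_erase hr)
        simp [h3, h4, sq]
  simp only [h2]
  have h3 : ∀ s : Fin l, ∑ s', (if s = s' then (∑ j, y j ^ 2) * (∑ i, x i ^ 2) ^ (l - 1)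
        else (∑ j, x j * y j) ^ 2 * (∑ i, x i ^ 2) ^ (l - 2))
      = (∑ j, y j ^ 2) * (∑ i, x i ^ 2) ^ (l - 1)
        + ((l - 1 : ℕ) : R) * ((∑ j, x j * y j) ^ 2 * (∑ i, x i ^ 2) ^ (l - 2)) := by
    intro s
    rw [← Finset.add_sum_erase _ _ (Finset.mem_univ s), if_pos rfl]
    congr 1
    rw [Finset.sum_congr rfl (g := fun _ => (∑ j, x j * y j) ^ 2 * (∑ i, x i ^ 2) ^ (l - 2)),
      Finset.sum_const, Finset.card_erase_of_mem (Finset.mem_univ s), Finset.card_univ,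
      Fintype.card_fin, nsmul_eq_mul]
    intro r hr
    rw [if_neg (Ne.symm (Finset.ne_of_mem_erase hr))]
  rw [Finset.sum_congr rfl fun s _ => h3 s, Finset.sum_const, Finset.card_univ, Fintype.card_fin,
    nsmul_eq_mul]
  push_cast
  ring

end TensorForm

/-! ### Sum-of-squares representations of nonnegative polynomials in one variable. -/

section UnivariatePositivity

open Polynomial

/-- A simple sign change at `a` is impossible: the cofactor of `X - a` is nonpositive to the left of
`a` and nonnegative to the right, so by continuity it vanishes at `a`. -/
theorem Polynomial.exists_sub_sq_mul_of_nonneg {p : ℝ[X]} (hp : ∀ x, 0 ≤ p.eval x)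
    {a : ℝ} (ha : p.eval a = 0) :
    ∃ r : ℝ[X], p = (X - C a) ^ 2 * r ∧ ∀ x, 0 ≤ r.eval x := by
  obtain ⟨q, rfl⟩ := dvd_iff_isRoot.2 ha
  have hq : q.eval a = 0 := by
    have hc : Continuous fun x => q.eval x := q.continuous
    apply le_antisymm
    · have h : ∀ x ∈ Set.Iio a, q.eval x ≤ 0 := fun x hx => by
        have := hp x
        simp only [eval_mul, eval_sub, eval_X, eval_C] at this
        have hx' : x - a < 0 := sub_neg.2 hx
        nlinarith
      have hcl : closure (Set.Iio a) ⊆ {x | q.eval x ≤ 0} :=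
        closure_minimal h (isClosed_le hc continuous_const)
      rw [closure_Iio] at hcl
      exact hcl (Set.mem_Iic.2 le_rfl)
    · have h : ∀ x ∈ Set.Ioi a, 0 ≤ q.eval x := fun x hx => by
        have := hp x
        simp only [eval_mul, eval_sub, eval_X, eval_C] at this
        have hx' : 0 < x - a := sub_pos.2 hx
        exact nonneg_of_mul_nonneg_right this hx'
      have hcl : closure (Set.Ioi a) ⊆ {x | 0 ≤ q.eval x} :=
        closure_minimal h (isClosed_le continuous_const hc)
      rw [closure_Ioi] at hcl
      exact hcl (Set.mem_Ici.2 le_rfl)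
  obtain ⟨r, rfl⟩ := dvd_iff_isRoot.2 hq
  refine ⟨r, by ring, ?_⟩
  have h : ∀ x ∈ ({a}ᶜ : Set ℝ), 0 ≤ r.eval x := fun x hx => by
    have := hp x
    simp only [← mul_assoc, ← sq, eval_mul, eval_pow, eval_sub, eval_X, eval_C] at this
    have hx' : 0 < (x - a) ^ 2 := by
      have : x - a ≠ 0 := sub_ne_zero.2 hx
      positivity
    exact nonneg_of_mul_nonneg_right this hx'
  have hcl : closure ({a}ᶜ : Set ℝ) ⊆ {x | 0 ≤ r.eval x} :=
    closure_minimal h (isClosed_le continuous_const r.continuous)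
  intro x
  exact hcl ((dense_compl_singleton a).closure_eq ▸ Set.mem_univ x)

/-- A nonnegative real polynomial in one variable is a sum of two squares. -/
theorem Polynomial.exists_eq_sq_add_sq (p : ℝ[X]) (hp : ∀ x, 0 ≤ p.eval x) :
    ∃ f g : ℝ[X], p = f ^ 2 + g ^ 2 ∧ 2 * f.natDegree ≤ p.natDegree ∧
      2 * g.natDegree ≤ p.natDegree := by
  induction hd : p.natDegree using Nat.strong_induction_on generalizing p with
  | _ d ih =>
    rcases Nat.eq_zero_or_pos d with h0 | hpos
    · rw [h0] at hd
      obtain ⟨c, rfl⟩ := natDegree_eq_zero.1 hd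
      have hc : 0 ≤ c := by simpa using hp 0
      refine ⟨C (Real.sqrt c), 0, ?_, by simp, by simp⟩
      rw [← C_pow, Real.sq_sqrt hc]; simp
    have hp0 : p ≠ 0 := by rintro rfl; simp at hd; omega
    by_cases hr : ∃ a, p.eval a = 0
    · obtain ⟨a, ha⟩ := hr
      obtain ⟨r, hpr, hrnn⟩ := Polynomial.exists_sub_sq_mul_of_nonneg hp ha
      have hr0 : r ≠ 0 := by rintro rfl; simp at hpr; exact hp0 hpr
      have hdeg : p.natDegree = 2 + r.natDegree := by
        rw [hpr, natDegree_mul (pow_ne_zero _ (X_sub_C_ne_zero a)) hr0, natDegree_pow,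
          natDegree_X_sub_C]
      obtain ⟨f, g, hfg, hf, hg⟩ := ih r.natDegree (by omega) r hrnn rfl
      have hle : ∀ h : ℝ[X], 2 * h.natDegree ≤ r.natDegree → 2 * ((X - C a) * h).natDegree ≤ d := by
        intro h hh
        have := natDegree_mul_le (p := X - C a) (q := h)
        rw [natDegree_X_sub_C] at this
        omega
      refine ⟨(X - C a) * f, (X - C a) * g, ?_, hle f hf, hle g hg⟩
      rw [hpr, hfg]; ring
    · push Not at hr
      obtain ⟨z, hz⟩ := IsAlgClosed.exists_aeval_eq_zero ℂ p (by
        rw [degree_eq_natDegree hp0, hd]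
        exact_mod_cast hpos.ne')
      have hzim : z.im ≠ 0 := by
        intro him
        apply hr z.re
        have hz' : z = (algebraMap ℝ ℂ z.re) := by
          apply Complex.ext <;> simp [him]
        rw [hz', aeval_algebraMap_apply] at hz
        simpa using hz
      obtain ⟨r, hpr⟩ := p.quadratic_dvd_of_aeval_eq_zero_im_ne_zero hz hzim
      have hq : (X ^ 2 - C (2 * z.re) * X + C (‖z‖ ^ 2) : ℝ[X])
          = (X - C z.re) ^ 2 + (C z.im) ^ 2 := by
        have : ‖z‖ ^ 2 = z.re ^ 2 + z.im ^ 2 := by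
          rw [← Complex.normSq_eq_norm_sq, Complex.normSq_apply]; ring
        rw [this]
        simp only [C_add, C_mul, C_pow, map_ofNat]
        ring
      rw [hq] at hpr
      have hr0 : r ≠ 0 := by rintro rfl; simp at hpr; exact hp0 hpr
      have hqdeg : ((X - C z.re) ^ 2 + (C z.im) ^ 2 : ℝ[X]).natDegree = 2 := by
        rw [← C_pow, natDegree_add_C, natDegree_pow, natDegree_X_sub_C]
      have hdeg : p.natDegree = 2 + r.natDegree := by
        rw [hpr, natDegree_mul _ hr0, hqdeg]
        intro h; rw [h] at hqdeg; simp at hqdeg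
      have hrnn : ∀ x, 0 ≤ r.eval x := by
        intro x
        have := hp x
        rw [hpr] at this
        simp only [eval_mul, eval_add, eval_pow, eval_sub, eval_X, eval_C] at this
        exact nonneg_of_mul_nonneg_right this (by positivity)
      obtain ⟨f, g, hfg, hf, hg⟩ := ih r.natDegree (by omega) r hrnn rfl
      have hm : ∀ h : ℝ[X], 2 * h.natDegree ≤ r.natDegree → 2 * ((X - C z.re) * h).natDegree ≤ d := by
        intro h hh
        have := natDegree_mul_le (p := X - C z.re) (q := h)
        rw [natDegree_X_sub_C] at this
        omega
      have hm' : ∀ h : ℝ[X], 2 * h.natDegree ≤ r.natDegree → 2 * (C z.im * h).natDegree ≤ d := by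
        intro h hh
        have := natDegree_C_mul_le z.im h
        omega
      -- Brahmagupta's identity for a product of two sums of two squares.
      refine ⟨(X - C z.re) * f - C z.im * g, (X - C z.re) * g + C z.im * f, ?_, ?_, ?_⟩
      · rw [hpr, hfg]; ring
      · have := natDegree_sub_le ((X - C z.re) * f) (C z.im * g)
        have h1 := hm f hf
        have h2 := hm' g hg
        omega
      · have := natDegree_add_le ((X - C z.re) * g) (C z.im * f)
        have h1 := hm g hg
        have h2 := hm' f hf
        omega

theorem Polynomial.eq_expand_contract_add (f : ℝ[X]) :
    f = expand ℝ 2 (contract 2 f) + X * expand ℝ 2 (contract 2 (divX f)) := by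
  ext k
  rcases Nat.even_or_odd' k with ⟨j, rfl | rfl⟩
  · rw [coeff_add, coeff_expand_mul' two_pos, coeff_contract two_ne_zero]
    rcases j with _ | j
    · simp
    · rw [show 2 * (j + 1) = (2 * j + 1) + 1 by ring, coeff_X_mul, coeff_expand two_pos, if_neg (by omega),
        add_zero]
      congr 1; ring
  · rw [coeff_add, coeff_expand two_pos, if_neg (by omega), coeff_X_mul, coeff_expand_mul' two_pos,
      coeff_contract two_ne_zero, coeff_divX, zero_add]
    congr 1; ring

theorem Polynomial.contract_X_mul_expand (f : ℝ[X]) : contract 2 (X * expand ℝ 2 f) = 0 := by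
  ext k
  rw [coeff_contract two_ne_zero]
  rcases k with _ | k
  · simp
  · rw [show (k + 1) * 2 = (2 * k + 1) + 1 by ring, coeff_X_mul, coeff_expand two_pos,
      if_neg (by omega), coeff_zero]

theorem Polynomial.two_mul_natDegree_contract_le (f : ℝ[X]) :
    2 * (contract 2 f).natDegree ≤ f.natDegree := by
  have : (contract 2 f).natDegree ≤ f.natDegree / 2 := by
    rw [natDegree_le_iff_coeff_eq_zero]
    intro k hk
    rw [coeff_contract two_ne_zero]
    exact coeff_eq_zero_of_natDegree_lt (by omega)
  omega

/-- A real polynomial which is nonnegative on `[0, ∞)` has the form `f₁² + f₂² + X (g₁² + g₂²)`. -/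
theorem Polynomial.exists_eq_sq_add_X_mul_sq (p : ℝ[X]) (hp : ∀ x, 0 ≤ x → 0 ≤ p.eval x) :
    ∃ f₁ f₂ g₁ g₂ : ℝ[X], p = f₁ ^ 2 + f₂ ^ 2 + X * (g₁ ^ 2 + g₂ ^ 2) ∧
      2 * f₁.natDegree ≤ p.natDegree ∧ 2 * f₂.natDegree ≤ p.natDegree ∧
      (g₁ = 0 ∨ 2 * g₁.natDegree + 1 ≤ p.natDegree) ∧
      (g₂ = 0 ∨ 2 * g₂.natDegree + 1 ≤ p.natDegree) := by
  -- Substituting `x²` makes the polynomial nonnegative on the whole line. Splitting `f` and `g`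
  -- into even and odd parts and keeping the even part of `f² + g²` undoes the substitution.
  obtain ⟨f, g, hfg, hf, hg⟩ := (expand ℝ 2 p).exists_eq_sq_add_sq (fun x => by
    rw [expand_eval]; exact hp _ (by positivity))
  rw [natDegree_expand] at hf hg
  have hodd : ∀ h : ℝ[X], 2 * h.natDegree ≤ p.natDegree * 2 →
      contract 2 (divX h) = 0 ∨ 2 * (contract 2 (divX h)).natDegree + 1 ≤ p.natDegree := by
    intro h hh
    by_cases h0 : divX h = 0
    · left; rw [h0]; ext k; rw [coeff_contract two_ne_zero]; simp
    · right
      have h1 := two_mul_natDegree_contract_le (divX h)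
      have h2 : h.natDegree ≠ 0 := fun hz => h0 (by
        rw [natDegree_eq_zero] at hz; obtain ⟨c, rfl⟩ := hz; exact divX_C c)
      have h3 := natDegree_divX_eq_natDegree_tsub_one (p := h)
      omega
  refine ⟨contract 2 f, contract 2 g, contract 2 (divX f), contract 2 (divX g), ?_, ?_, ?_,
    hodd f hf, hodd g hg⟩
  · set f0 := contract 2 f
    set g0 := contract 2 g
    set f1 := contract 2 (divX f)
    set g1 := contract 2 (divX g)
    have e1 : f = expand ℝ 2 f0 + X * expand ℝ 2 f1 := eq_expand_contract_add f
    have e2 : g = expand ℝ 2 g0 + X * expand ℝ 2 g1 := eq_expand_contract_add g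
    have e3 : expand ℝ 2 p = expand ℝ 2 (f0 ^ 2 + g0 ^ 2 + X * (f1 ^ 2 + g1 ^ 2))
        + X * expand ℝ 2 (2 * (f0 * f1 + g0 * g1)) := by
      rw [hfg, e1, e2]
      simp only [map_add, map_mul, map_pow, expand_X, map_ofNat]
      ring
    have e4 := congrArg (contract 2) e3
    rwa [contract_add two_ne_zero, contract_X_mul_expand, contract_expand _ two_ne_zero,
      contract_expand _ two_ne_zero, add_zero] at e4
  · have := two_mul_natDegree_contract_le f; omega
  · have := two_mul_natDegree_contract_le g; omega

end UnivariatePositivity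

/-! ### A Bernstein-type estimate on `[0, ∞)`. -/

section BernsteinEstimate

/-- With `z = u(1 - u/4)` and `W = (1 - u/2)²`, `z + W = 1`, the summands are essentially binomial
probabilities, and `1/√(k+1)` should average to about `1/√(dz)`. The extra `u² ≤ 4z` cancels the
blow-up as `z → 0`. -/
theorem sum_choose_mul_sq_pow_le_of_le_two (d : ℕ) {u : ℝ} (hu0 : 0 ≤ u) (hu2 : u ≤ 2) :
    ∑ k ∈ Finset.range (d + 1), (d.choose k : ℝ) * (1 / Real.sqrt (k + 1)) *
      (u ^ (k + 2) * ((1 - u / 4) ^ (k / 2) * (1 - u / 2) ^ (d - k)) ^ 2) ≤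
      8 / Real.sqrt (d + 1) := by
  set z := u * (1 - u / 4) with hz
  set W := (1 - u / 2) ^ 2 with hW
  have hzW : z + W = 1 := by rw [hz, hW]; ring
  have hz0 : 0 ≤ z := mul_nonneg hu0 (by linarith)
  have hW0 : 0 ≤ W := sq_nonneg _
  set D := Real.sqrt (d + 1) with hD
  have hDpos : 0 < D := Real.sqrt_pos.2 (by positivity)
  have hD2 : D ^ 2 = d + 1 := Real.sq_sqrt (by positivity)
  have hmon : ∀ k : ℕ, u ^ k * (1 - u / 4) ^ (2 * (k / 2)) ≤ 2 * z ^ k := by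
    intro k
    have h4 : 0 ≤ 1 - u / 4 := by linarith
    rw [hz, mul_pow]
    rcases Nat.even_or_odd' k with ⟨j, rfl | rfl⟩
    · rw [Nat.mul_div_cancel_left j two_pos]
      have : 0 ≤ u ^ (2 * j) * (1 - u / 4) ^ (2 * j) := by positivity
      linarith
    · rw [show (2 * j + 1) / 2 = j by omega, pow_succ (1 - u / 4)]
      have : 0 ≤ u ^ (2 * j + 1) * (1 - u / 4) ^ (2 * j) := by positivity
      nlinarith
  have hterm : ∀ k ∈ Finset.range (d + 1), (d.choose k : ℝ) * (1 / Real.sqrt (k + 1)) *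
      (u ^ (k + 2) * ((1 - u / 4) ^ (k / 2) * (1 - u / 2) ^ (d - k)) ^ 2) ≤
      4 / D * (z ^ (k + 1) * W ^ (d + 1 - (k + 1)) * ((d + 1).choose (k + 1) : ℝ))
        + 4 / D * (z ^ k * W ^ (d - k) * (d.choose k : ℝ)) := by
    intro k hk
    set s := Real.sqrt (k + 1) with hs
    have hspos : 0 < s := Real.sqrt_pos.2 (by positivity)
    have hs2 : s ^ 2 = k + 1 := Real.sq_sqrt (by positivity)
    have e1 : u ^ (k + 2) * ((1 - u / 4) ^ (k / 2) * (1 - u / 2) ^ (d - k)) ^ 2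
        = u ^ 2 * (u ^ k * (1 - u / 4) ^ (2 * (k / 2))) * W ^ (d - k) := by
      rw [hW]; generalize 1 - u / 4 = a; generalize 1 - u / 2 = b; ring
    have hch : ((d + 1).choose (k + 1) : ℝ) * s ^ 2 = (d.choose k : ℝ) * D ^ 2 := by
      rw [hs2, hD2]
      have := Nat.add_one_mul_choose_eq d k
      have h' : ((d : ℝ) + 1) * d.choose k = ((d + 1).choose (k + 1) : ℝ) * (k + 1) := by
        exact_mod_cast this
      linarith
    -- AM-GM linearises `1/√(k+1)` into multiples of `1/(k+1)` and `1`. The former turns `d.choose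
    -- k` into `(d+1).choose (k+1)`, so both sums are evaluated by the binomial theorem.
    have h1s : 1 / s ≤ 1 / 2 * (D / s ^ 2) + 1 / 2 * (1 / D) := by
      have : 1 / 2 * (D / s ^ 2) + 1 / 2 * (1 / D) - 1 / s = (D - s) ^ 2 / (2 * D * s ^ 2) := by
        field_simp; ring
      have h2 : 0 ≤ (D - s) ^ 2 / (2 * D * s ^ 2) := by positivity
      linarith
    have hu2z : u ^ 2 * (2 * z ^ k) ≤ 8 * z ^ (k + 1) := by
      have : u ^ 2 ≤ 4 * z := by rw [hz]; nlinarith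
      calc u ^ 2 * (2 * z ^ k) ≤ 4 * z * (2 * z ^ k) := by gcongr
        _ = _ := by ring
    have hu2z' : u ^ 2 * (2 * z ^ k) ≤ 8 * z ^ k := by
      have : u ^ 2 ≤ 4 := by nlinarith
      calc u ^ 2 * (2 * z ^ k) ≤ 4 * (2 * z ^ k) := by gcongr
        _ = _ := by ring
    have hWk : 0 ≤ W ^ (d - k) := by positivity
    have hcd : (0 : ℝ) ≤ d.choose k := by positivity
    rw [e1, show d + 1 - (k + 1) = d - k by omega]
    calc (d.choose k : ℝ) * (1 / s) * (u ^ 2 * (u ^ k * (1 - u / 4) ^ (2 * (k / 2))) * W ^ (d - k))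
        ≤ (d.choose k : ℝ) * (1 / s) * (u ^ 2 * (2 * z ^ k) * W ^ (d - k)) := by
          exact mul_le_mul_of_nonneg_left (mul_le_mul_of_nonneg_right
            (mul_le_mul_of_nonneg_left (hmon k) (sq_nonneg u)) hWk) (by positivity)
      _ ≤ (d.choose k : ℝ) * (1 / 2 * (D / s ^ 2) + 1 / 2 * (1 / D)) *
          (u ^ 2 * (2 * z ^ k) * W ^ (d - k)) := by gcongr
      _ = 1 / 2 * ((d.choose k : ℝ) * (D / s ^ 2)) * (u ^ 2 * (2 * z ^ k) * W ^ (d - k))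
          + 1 / 2 * ((d.choose k : ℝ) * (1 / D)) * (u ^ 2 * (2 * z ^ k) * W ^ (d - k)) := by ring
      _ ≤ 1 / 2 * ((d.choose k : ℝ) * (D / s ^ 2)) * (8 * z ^ (k + 1) * W ^ (d - k))
          + 1 / 2 * ((d.choose k : ℝ) * (1 / D)) * (8 * z ^ k * W ^ (d - k)) := by gcongr
      _ = _ := by
          have : (d.choose k : ℝ) * (D / s ^ 2) = ((d + 1).choose (k + 1) : ℝ) / D := by
            rw [← mul_div_assoc, div_eq_div_iff (by positivity) (by positivity), hch]; ring
          rw [this]; ring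
  refine (Finset.sum_le_sum hterm).trans ?_
  rw [Finset.sum_add_distrib, ← Finset.mul_sum, ← Finset.mul_sum, ← add_pow, hzW, one_pow]
  have h2 : ∑ k ∈ Finset.range (d + 1), z ^ (k + 1) * W ^ (d + 1 - (k + 1))
      * ((d + 1).choose (k + 1) : ℝ) ≤ 1 := by
    have := add_pow z W (d + 1)
    rw [hzW, one_pow, Finset.sum_range_succ'] at this
    have h0 : 0 ≤ z ^ 0 * W ^ (d + 1 - 0) * ((d + 1).choose 0 : ℝ) := by positivity
    linarith
  calc _ ≤ 4 / D * 1 + 4 / D * 1 := by gcongr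
    _ = _ := by ring

/-- No averaging is needed: each summand is at most `2u² (u²/4)^d` times a binomial coefficient, and
the spare factor `2^{-d}` after summation is below `1/√(d+1)`. -/
theorem sum_choose_mul_sq_pow_le_of_two_le (d : ℕ) {u : ℝ} (hu2 : 2 ≤ u) :
    ∑ k ∈ Finset.range (d + 1), (d.choose k : ℝ) * (1 / Real.sqrt (k + 1)) *
      (u ^ (k + 2) * ((1 - u / 4) ^ (k / 2) * (1 - u / 2) ^ (d - k)) ^ 2) ≤
      8 / Real.sqrt (d + 1) * u ^ (2 * d + 2) := by
  have hu0 : 0 ≤ u := by linarith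
  set y := u ^ 2 / 4 with hy
  have hy0 : 0 ≤ y := by positivity
  have hmon : ∀ k : ℕ, u ^ k * ((1 - u / 4) ^ 2) ^ (k / 2) ≤ 2 * y ^ k := by
    intro k
    have h4 : (1 - u / 4) ^ 2 ≤ u ^ 2 / 16 := by nlinarith
    have h5 : ((1 - u / 4) ^ 2) ^ (k / 2) ≤ (u ^ 2 / 16) ^ (k / 2) := by gcongr
    refine (mul_le_mul_of_nonneg_left h5 (by positivity)).trans ?_
    rcases Nat.even_or_odd' k with ⟨j, rfl | rfl⟩
    · rw [Nat.mul_div_cancel_left j two_pos, pow_mul, pow_mul, ← mul_pow]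
      have : u ^ 2 * (u ^ 2 / 16) = y ^ 2 := by rw [hy]; ring
      rw [this]
      have : 0 ≤ (y ^ 2) ^ j := by positivity
      linarith
    · rw [show (2 * j + 1) / 2 = j by omega, pow_succ u, pow_succ y, pow_mul, pow_mul]
      have : (u ^ 2) ^ j * u * (u ^ 2 / 16) ^ j = (y ^ 2) ^ j * u := by
        rw [mul_right_comm, ← mul_pow]; congr 2; rw [hy]; ring
      rw [this]
      have h6 : 0 ≤ (y ^ 2) ^ j := by positivity
      have h7 : u ≤ 2 * y := by rw [hy]; nlinarith
      nlinarith
  have hW : (1 - u / 2) ^ 2 ≤ y := by rw [hy]; nlinarith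
  have hterm : ∀ k ∈ Finset.range (d + 1), (d.choose k : ℝ) * (1 / Real.sqrt (k + 1)) *
      (u ^ (k + 2) * ((1 - u / 4) ^ (k / 2) * (1 - u / 2) ^ (d - k)) ^ 2) ≤
      2 * u ^ 2 * y ^ d * (d.choose k : ℝ) := by
    intro k hk
    have hk' : k ≤ d := by have := Finset.mem_range.1 hk; omega
    have hs : 1 / Real.sqrt (k + 1) ≤ 1 := by
      rw [div_le_one (Real.sqrt_pos.2 (by positivity)), Real.one_le_sqrt]
      have : (0 : ℝ) ≤ k := by positivity
      linarith
    have e1 : u ^ (k + 2) * ((1 - u / 4) ^ (k / 2) * (1 - u / 2) ^ (d - k)) ^ 2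
        = u ^ 2 * (u ^ k * ((1 - u / 4) ^ 2) ^ (k / 2)) * ((1 - u / 2) ^ 2) ^ (d - k) := by
      generalize 1 - u / 4 = a; generalize 1 - u / 2 = b; ring
    rw [e1]
    calc _ ≤ (d.choose k : ℝ) * 1 * (u ^ 2 * (2 * y ^ k) * y ^ (d - k)) := by
          have := hmon k
          gcongr ?_ * ?_ * ?_
          gcongr ?_ * ?_ * ?_
          gcongr
      _ = 2 * u ^ 2 * (y ^ k * y ^ (d - k)) * (d.choose k : ℝ) := by ring
      _ = _ := by rw [← pow_add, Nat.add_sub_cancel' hk']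
  refine (Finset.sum_le_sum hterm).trans ?_
  rw [← Finset.mul_sum]
  have hc : ∑ k ∈ Finset.range (d + 1), (d.choose k : ℝ) = 2 ^ d := by
    exact_mod_cast Nat.sum_range_choose d
  rw [hc]
  have h1 : 2 * u ^ 2 * y ^ d * 2 ^ d = 2 * u ^ (2 * d + 2) / 2 ^ d := by
    rw [eq_div_iff (by positivity), mul_assoc (2 * u ^ 2), mul_assoc (2 * u ^ 2), ← mul_pow,
      ← mul_pow]
    have : y * 2 * 2 = u ^ 2 := by rw [hy]; ring
    rw [this]; ring
  rw [h1]
  have h2 : Real.sqrt (d + 1) ≤ 2 ^ d := by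
    rw [Real.sqrt_le_left (by positivity)]
    have h3 : (d : ℝ) + 1 ≤ 2 ^ d := by
      exact_mod_cast Nat.lt_two_pow_self (n := d)
    have h4 : (1 : ℝ) ≤ 2 ^ d := one_le_pow₀ (by norm_num)
    nlinarith
  have hs : 0 < Real.sqrt (d + 1) := Real.sqrt_pos.2 (by positivity)
  have hup : 0 ≤ u ^ (2 * d + 2) := by positivity
  calc 2 * u ^ (2 * d + 2) / 2 ^ d ≤ 2 * u ^ (2 * d + 2) / Real.sqrt (d + 1) := by gcongr
    _ ≤ 8 * u ^ (2 * d + 2) / Real.sqrt (d + 1) := by gcongr; norm_num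
    _ = _ := by ring

theorem sum_choose_mul_sq_pow_le {d N : ℕ} (hN : 2 * d + 2 ≤ N) {u : ℝ} (hu0 : 0 ≤ u) :
    ∑ k ∈ Finset.range (d + 1), (d.choose k : ℝ) * (1 / Real.sqrt (k + 1)) *
      (u ^ (k + 2) * ((1 - u / 4) ^ (k / 2) * (1 - u / 2) ^ (d - k)) ^ 2) ≤
      8 / Real.sqrt (d + 1) * (1 + u ^ N) := by
  have hc : 0 ≤ 8 / Real.sqrt (d + 1) := by positivity
  rcases le_total u 2 with h | h
  · refine (sum_choose_mul_sq_pow_le_of_le_two d hu0 h).trans ?_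
    have : 0 ≤ u ^ N := by positivity
    nlinarith
  · refine (sum_choose_mul_sq_pow_le_of_two_le d h).trans ?_
    refine mul_le_mul_of_nonneg_left ?_ hc
    have : u ^ (2 * d + 2) ≤ u ^ N := pow_le_pow_right₀ (by linarith) hN
    linarith

end BernsteinEstimate

/-! ### Pseudo-moments of powers of the norm, and removal of the norm factor. -/

section PseudoMoments

open MvPolynomial

variable {n N : ℕ}

/-- The polynomial `‖x‖²`. -/
noncomputable def normSqPoly (n : ℕ) : MvPolynomial (Fin n) ℝ := ∑ i, X i ^ 2

/-- A linear functional on polynomials which behaves, up to degree `2 N`, like a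
pseudo-expectation with `𝔼 ‖x‖^{2N} = 1`. -/
structure IsPseudoMoment (N : ℕ) (L : MvPolynomial (Fin n) ℝ →ₗ[ℝ] ℝ) : Prop where
  map_one : L 1 = 1
  sq_nonneg : ∀ p : MvPolynomial (Fin n) ℝ, p.totalDegree ≤ N → 0 ≤ L (p ^ 2)
  map_normSq : L (normSqPoly n ^ N) = 1

theorem totalDegree_normSqPoly_le : (normSqPoly n).totalDegree ≤ 2 :=
  totalDegree_finsetSum_le fun i _ => (totalDegree_pow _ _).trans (by simp [totalDegree_X])

theorem totalDegree_tensorMonomial_le {l : ℕ} (t : Fin l → Fin n) :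
    (tensorMonomial (X : Fin n → MvPolynomial (Fin n) ℝ) t).totalDegree ≤ l :=
  (totalDegree_finsetProd _ _).trans (by simp [totalDegree_X])

theorem normSqPoly_pow_eq (l : ℕ) :
    normSqPoly n ^ l = ∑ t : Fin l → Fin n, tensorMonomial X t ^ 2 := by
  rw [normSqPoly, ← tensorForm_one (l := l)]
  unfold tensorForm
  simp [Matrix.one_apply, ite_smul, sq]

theorem totalDegree_aeval_normSqPoly_le (p : Polynomial ℝ) :
    (Polynomial.aeval (normSqPoly n) p).totalDegree ≤ 2 * p.natDegree := by
  rw [Polynomial.aeval_eq_sum_range]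
  refine totalDegree_finsetSum_le fun i hi => ?_
  refine (totalDegree_smul_le _ _).trans ((totalDegree_pow _ _).trans ?_)
  have h1 := Finset.mem_range.1 hi
  have h2 := totalDegree_normSqPoly_le (n := n)
  calc i * (normSqPoly n).totalDegree ≤ p.natDegree * 2 := Nat.mul_le_mul (by omega) h2
    _ = _ := mul_comm _ _

namespace IsPseudoMoment

variable {L : MvPolynomial (Fin n) ℝ →ₗ[ℝ] ℝ}

/-- `‖x‖^{2j}` is the sum of the squares of the coordinates of `x^{⊗ j}`. -/
theorem normSq_pow_mul_sq_nonneg (hL : IsPseudoMoment N L) {p : MvPolynomial (Fin n) ℝ} {j : ℕ}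
    (hp : p.totalDegree + j ≤ N) : 0 ≤ L (normSqPoly n ^ j * p ^ 2) := by
  rw [normSqPoly_pow_eq, Finset.sum_mul, map_sum]
  refine Finset.sum_nonneg fun t _ => ?_
  rw [← mul_pow]
  refine hL.sq_nonneg _ ((totalDegree_mul _ _).trans ?_)
  have := totalDegree_tensorMonomial_le t
  omega

theorem aeval_normSq_nonneg (hL : IsPseudoMoment N L) {p : Polynomial ℝ} (hpN : p.natDegree ≤ N)
    (hp : ∀ x, 0 ≤ x → 0 ≤ p.eval x) : 0 ≤ L (Polynomial.aeval (normSqPoly n) p) := by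
  obtain ⟨f₁, f₂, g₁, g₂, hpe, hf₁, hf₂, hg₁, hg₂⟩ := p.exists_eq_sq_add_X_mul_sq hp
  rw [hpe]
  simp only [map_add, map_mul, map_pow, Polynomial.aeval_X, mul_add]
  have hf : ∀ f : Polynomial ℝ, 2 * f.natDegree ≤ p.natDegree →
      0 ≤ L (Polynomial.aeval (normSqPoly n) f ^ 2) := fun f h =>
    hL.sq_nonneg _ ((totalDegree_aeval_normSqPoly_le f).trans (h.trans hpN))
  have hg : ∀ g : Polynomial ℝ, (g = 0 ∨ 2 * g.natDegree + 1 ≤ p.natDegree) →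
      0 ≤ L (normSqPoly n * Polynomial.aeval (normSqPoly n) g ^ 2) := by
    rintro g (rfl | h)
    · simp
    · have h1 := totalDegree_aeval_normSqPoly_le (n := n) g
      have := hL.normSq_pow_mul_sq_nonneg (p := Polynomial.aeval (normSqPoly n) g) (j := 1)
        (by omega)
      rwa [pow_one] at this
  have := hf f₁ hf₁
  have := hf f₂ hf₂
  have := hg g₁ hg₁
  have := hg g₂ hg₂
  linarith

theorem map_aeval_C_mul (c : ℝ) (p : Polynomial ℝ) (u : MvPolynomial (Fin n) ℝ) :
    L (Polynomial.aeval u (Polynomial.C c * p)) = c * L (Polynomial.aeval u p) := by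
  rw [map_mul, Polynomial.aeval_C, ← Algebra.smul_def, map_smul, smul_eq_mul]

theorem map_normSq_pow_le_one (hL : IsPseudoMoment N L) {j : ℕ} (hj : 0 < j) (hjN : j ≤ N) :
    L (normSqPoly n ^ j) ≤ 1 := by
  have hN : (0 : ℝ) < N := by exact_mod_cast lt_of_lt_of_le hj hjN
  set c : ℝ := (j : ℝ) / N with hc
  have hc1 : c ≤ 1 := by rw [hc, div_le_one hN]; exact_mod_cast hjN
  have hc0 : 0 ≤ c := by positivity
  -- Weighted AM-GM gives `x^j ≤ (1 - j/N) + (j/N) x^N` on `[0, ∞)`, and `L` is `1` on both `1` and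
  -- `u^N`.
  have h := hL.aeval_normSq_nonneg
    (p := Polynomial.C (1 - c) * 1 + Polynomial.C c * Polynomial.X ^ N - Polynomial.X ^ j) (by
      refine (Polynomial.natDegree_sub_le_of_le (m := N) (Polynomial.natDegree_add_le_of_degree_le
        (by simp) (Polynomial.natDegree_C_mul_X_pow_le _ _)) (n := N) ?_).trans (by simp)
      rw [Polynomial.natDegree_X_pow]; exact hjN) (by
      intro x hx
      simp only [Polynomial.eval_sub, Polynomial.eval_add, Polynomial.eval_mul,
        Polynomial.eval_C, Polynomial.eval_pow, Polynomial.eval_X, Polynomial.eval_one]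
      have h1 := Real.geom_mean_le_arith_mean2_weighted (sub_nonneg.2 hc1) hc0 zero_le_one
        (pow_nonneg hx N) (by ring)
      have h2 : (x ^ N) ^ c = x ^ j := by
        rw [← Real.rpow_natCast x N, ← Real.rpow_mul hx, hc, mul_div_cancel₀ _ hN.ne',
          Real.rpow_natCast]
      rw [Real.one_rpow, one_mul, h2] at h1
      linarith)
  rw [map_sub, map_sub, map_add, map_add, map_aeval_C_mul, map_aeval_C_mul, _root_.map_one, hL.map_one,
    map_pow, Polynomial.aeval_X, hL.map_normSq, map_pow, Polynomial.aeval_X] at h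
  linarith

/-- Certificates with a factor `‖x‖^{2k}` at rate `Λ / √(k+1)`, for all `k ≤ d`, combine to a
certificate without that factor at rate `Λ / √(d+1)`. -/
theorem le_of_forall_normSq_pow_mul_le (hL : IsPseudoMoment N L) {ι : Type*} [Fintype ι]
    (g : ι → MvPolynomial (Fin n) ℝ) (hg : ∀ i, (g i).totalDegree ≤ 2) {d : ℕ}
    (hd : 2 * d + 2 ≤ N) {Λ : ℝ} (hΛ : 0 ≤ Λ)
    (h : ∀ (k : ℕ) (w : MvPolynomial (Fin n) ℝ), w.totalDegree + (k + 2) ≤ N →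
      L ((∑ i, g i ^ 2) * (normSqPoly n ^ k * w ^ 2)) ≤
        Λ * (1 / Real.sqrt (k + 1)) * L (normSqPoly n ^ (k + 2) * w ^ 2)) :
    L (∑ i, g i ^ 2) ≤ 16 * Λ / Real.sqrt (d + 1) := by
  set u := normSqPoly n with hu
  set F := ∑ i, g i ^ 2 with hF
  set q : MvPolynomial (Fin n) ℝ := C (1 / 4) with hq
  have hq4 : 4 * q = 1 := by
    rw [hq, show (4 : MvPolynomial (Fin n) ℝ) = C 4 from (map_ofNat C 4).symm, ← C_mul]; norm_num
  set a := 1 - q * u with ha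
  set b := 1 - 2 * q * u with hb
  have hu2 : u.totalDegree ≤ 2 := totalDegree_normSqPoly_le
  have hqu : (q * u).totalDegree ≤ 2 :=
    (totalDegree_mul _ _).trans (by rw [hq, totalDegree_C]; omega)
  have ha2 : a.totalDegree ≤ 2 := (totalDegree_sub _ _).trans (by simp [hqu])
  have hb2 : b.totalDegree ≤ 2 := by
    refine (totalDegree_sub _ _).trans ?_
    rw [mul_assoc, show (2 : MvPolynomial (Fin n) ℝ) = C 2 from (map_ofNat C 2).symm]
    have := totalDegree_mul (C 2) (q * u)
    rw [totalDegree_C] at this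
    simp only [totalDegree_one]
    omega
  have hw2 : ∀ i j, (a ^ i * b ^ j).totalDegree ≤ 2 * i + 2 * j := by
    intro i j
    have h1 := totalDegree_mul (a ^ i) (b ^ j)
    have h2 := totalDegree_pow a i
    have h3 := totalDegree_pow b j
    have h4 := Nat.mul_le_mul_left i ha2
    have h5 := Nat.mul_le_mul_left j hb2
    omega
  have hone : u * a + b ^ 2 = 1 := by
    rw [ha, hb]
    linear_combination (-u + q * u ^ 2) * hq4
  clear_value a b
  have hexp : F = ∑ k ∈ Finset.range (d + 1),
      (d.choose k : ℝ) • (F * ((u * a) ^ k * (b ^ 2) ^ (d - k))) := by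
    conv_lhs => rw [← mul_one F, ← one_pow d, ← hone, add_pow, Finset.mul_sum]
    refine Finset.sum_congr rfl fun k _ => ?_
    rw [smul_eq_C_mul, map_natCast]
    ring
  -- For odd `k` the power `a^k` is not a square. One factor `a` is replaced by `1`, at the cost of
  -- `1 - a = u/4`, which gives a sum of squares.
  have hterm : ∀ k ∈ Finset.range (d + 1), L (F * ((u * a) ^ k * (b ^ 2) ^ (d - k))) ≤
      L (F * (u ^ k * (a ^ (k / 2) * b ^ (d - k)) ^ 2)) := by
    intro k hk
    have hk' : k ≤ d := by have := Finset.mem_range.1 hk; omega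
    rcases Nat.even_or_odd' k with ⟨j, rfl | rfl⟩
    · apply le_of_eq
      rw [Nat.mul_div_cancel_left j two_pos]
      congr 1
      ring
    · rw [show (2 * j + 1) / 2 = j by omega]
      have e : F * (u ^ (2 * j + 1) * (a ^ j * b ^ (d - (2 * j + 1))) ^ 2)
          - F * ((u * a) ^ (2 * j + 1) * (b ^ 2) ^ (d - (2 * j + 1)))
          = (1 / 4 : ℝ) • ∑ i, u ^ (2 * j + 2) * (g i * (a ^ j * b ^ (d - (2 * j + 1)))) ^ 2 := by
        rw [smul_eq_C_mul, ← hq, ← Finset.mul_sum]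
        simp only [mul_pow (g _)]
        rw [← Finset.sum_mul, ← hF]
        have : q * u = 1 - a := by rw [ha]; ring
        linear_combination (-(F * u ^ (2 * j + 1) * (a ^ j * b ^ (d - (2 * j + 1))) ^ 2)) * this
      have hnn : 0 ≤ L (F * (u ^ (2 * j + 1) * (a ^ j * b ^ (d - (2 * j + 1))) ^ 2)
          - F * ((u * a) ^ (2 * j + 1) * (b ^ 2) ^ (d - (2 * j + 1)))) := by
        rw [e, map_smul, map_sum, smul_eq_mul]
        refine mul_nonneg (by norm_num) (Finset.sum_nonneg fun i _ => ?_)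
        refine hL.normSq_pow_mul_sq_nonneg ?_
        have h1 := totalDegree_mul (g i) (a ^ j * b ^ (d - (2 * j + 1)))
        have h2 := hg i
        have h3 := hw2 j (d - (2 * j + 1))
        omega
      rw [map_sub] at hnn
      linarith
  have hstep : L F ≤ Λ * ∑ k ∈ Finset.range (d + 1), (d.choose k : ℝ) * (1 / Real.sqrt (k + 1)) *
      L (u ^ (k + 2) * (a ^ (k / 2) * b ^ (d - k)) ^ 2) := by
    conv_lhs => rw [hexp, map_sum]
    rw [Finset.mul_sum]
    refine Finset.sum_le_sum fun k hk => ?_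
    have hk' : k ≤ d := by have := Finset.mem_range.1 hk; omega
    rw [map_smul, smul_eq_mul]
    have h1 := h k (a ^ (k / 2) * b ^ (d - k)) (by
      have := hw2 (k / 2) (d - k)
      omega)
    calc _ ≤ (d.choose k : ℝ) * (Λ * (1 / Real.sqrt (k + 1)) *
          L (u ^ (k + 2) * (a ^ (k / 2) * b ^ (d - k)) ^ 2)) :=
          mul_le_mul_of_nonneg_left ((hterm k hk).trans h1) (by positivity)
      _ = _ := by ring
  have hbern : ∑ k ∈ Finset.range (d + 1), (d.choose k : ℝ) * (1 / Real.sqrt (k + 1)) *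
      L (u ^ (k + 2) * (a ^ (k / 2) * b ^ (d - k)) ^ 2) ≤ 16 / Real.sqrt (d + 1) := by
    let A : Polynomial ℝ := 1 - Polynomial.C (1 / 4) * Polynomial.X
    let B : Polynomial ℝ := 1 - Polynomial.C (1 / 2) * Polynomial.X
    let S : Polynomial ℝ := ∑ k ∈ Finset.range (d + 1),
      Polynomial.C ((d.choose k : ℝ) * (1 / Real.sqrt (k + 1))) *
        (Polynomial.X ^ (k + 2) * (A ^ (k / 2) * B ^ (d - k)) ^ 2)
    -- The difference of the two sides of the Bernstein estimate, in the variable `u`. Since `L (1 +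
    -- u^N) = 2`, the constant `8` doubles to `16`.
    let P : Polynomial ℝ := Polynomial.C (8 / Real.sqrt (d + 1)) * (1 + Polynomial.X ^ N) - S
    have hlin : ∀ c : ℝ, (1 - Polynomial.C c * Polynomial.X : Polynomial ℝ).natDegree ≤ 1 := by
      intro c
      refine (Polynomial.natDegree_sub_le _ _).trans ?_
      simpa using (Polynomial.natDegree_C_mul_le c Polynomial.X)
    have hSdeg : S.natDegree ≤ N := by
      refine Polynomial.natDegree_sum_le_of_forall_le _ _ fun k hk => ?_
      have hk' : k ≤ d := by have := Finset.mem_range.1 hk; omega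
      refine (Polynomial.natDegree_C_mul_le _ _).trans ?_
      have e1 := Polynomial.natDegree_mul_le (p := Polynomial.X ^ (k + 2))
        (q := (A ^ (k / 2) * B ^ (d - k)) ^ 2)
      rw [Polynomial.natDegree_X_pow] at e1
      have e2 := Polynomial.natDegree_pow_le (p := A ^ (k / 2) * B ^ (d - k)) (n := 2)
      have e3 := Polynomial.natDegree_mul_le (p := A ^ (k / 2)) (q := B ^ (d - k))
      have e4 := (Polynomial.natDegree_pow_le (p := A) (n := k / 2)).trans
        (Nat.mul_le_mul_left _ (hlin (1 / 4)))
      have e5 := (Polynomial.natDegree_pow_le (p := B) (n := d - k)).trans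
        (Nat.mul_le_mul_left _ (hlin (1 / 2)))
      omega
    have hPdeg : P.natDegree ≤ N := by
      refine (Polynomial.natDegree_sub_le _ _).trans (max_le ?_ hSdeg)
      refine (Polynomial.natDegree_C_mul_le _ _).trans ((Polynomial.natDegree_add_le _ _).trans ?_)
      simp
    have hPnn := hL.aeval_normSq_nonneg (p := P) hPdeg (by
      intro x hx
      have := sum_choose_mul_sq_pow_le hd hx
      simp only [P, S, A, B, Polynomial.eval_sub, Polynomial.eval_add, Polynomial.eval_mul,
        Polynomial.eval_C, Polynomial.eval_pow, Polynomial.eval_X, Polynomial.eval_one,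
        Polynomial.eval_finsetSum]
      rw [sub_nonneg]
      simp only [one_div_mul_eq_div]
      exact this)
    have hA : Polynomial.aeval u A = a := by
      simp [A, ha, hq, MvPolynomial.algebraMap_eq]
    have hB : Polynomial.aeval u B = b := by
      have : 2 * q = C (1 / 2) := by
        rw [hq, show (2 : MvPolynomial (Fin n) ℝ) = C 2 from (map_ofNat C 2).symm, ← C_mul]; norm_num
      rw [hb, this]
      simp [B, MvPolynomial.algebraMap_eq]
    have hPe : L (Polynomial.aeval u P) = 8 / Real.sqrt (d + 1) * 2
        - ∑ k ∈ Finset.range (d + 1), (d.choose k : ℝ) * (1 / Real.sqrt (k + 1)) *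
          L (u ^ (k + 2) * (a ^ (k / 2) * b ^ (d - k)) ^ 2) := by
      simp only [P, S]
      rw [map_sub, map_sub, map_aeval_C_mul, map_sum, map_sum, map_add, map_add, _root_.map_one,
        hL.map_one, map_pow, Polynomial.aeval_X, hL.map_normSq]
      congr 1
      · norm_num
      · refine Finset.sum_congr rfl fun k _ => ?_
        rw [map_aeval_C_mul]
        simp only [map_mul, map_pow, Polynomial.aeval_X, hA, hB]
    rw [hPe] at hPnn
    have : 8 / Real.sqrt (d + 1) * 2 = 16 / Real.sqrt (d + 1) := by ring
    linarith
  calc L F ≤ Λ * (16 / Real.sqrt (d + 1)) :=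
        hstep.trans (mul_le_mul_of_nonneg_left hbern hΛ)
    _ = _ := by ring

end IsPseudoMoment

end PseudoMoments

/-! ### Quadratic forms of matrices with values in a commutative algebra. -/

section QuadForm

variable {n : ℕ} {R : Type*} [CommRing R] [Algebra ℝ R]

/-- The quadratic form `xᵀ B x`. -/
def quadForm (B : Matrix (Fin n) (Fin n) ℝ) (x : Fin n → R) : R := ∑ j, x j * ∑ k, B j k • x k

theorem quadForm_sum_smul {M : Type*} (S : Finset M) (c : M → ℝ)
    (B : M → Matrix (Fin n) (Fin n) ℝ) (x : Fin n → R) :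
    quadForm (∑ m ∈ S, c m • B m) x = ∑ m ∈ S, c m • quadForm (B m) x := by
  unfold quadForm
  simp only [Matrix.sum_apply, Matrix.smul_apply, Finset.sum_smul, Finset.smul_sum, Finset.mul_sum,
    smul_eq_mul, mul_smul, mul_smul_comm]
  calc _ = ∑ j, ∑ m ∈ S, ∑ k, c m • B m j k • (x j * x k) :=
        Finset.sum_congr rfl fun j _ => Finset.sum_comm
    _ = _ := Finset.sum_comm

theorem quadForm_symUnit (p : Fin n × Fin n) (x : Fin n → R) :
    quadForm (symUnit p) x = x p.1 * x p.2 := by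
  have h : ∀ a b : Fin n, quadForm (Matrix.single a b (1 : ℝ)) x = x a * x b := by
    intro a b
    unfold quadForm
    rw [Finset.sum_eq_single a]
    · rw [Finset.sum_eq_single b]
      · simp
      · intro k _ hk; simp [hk.symm]
      · simp
    · intro j _ hj; simp [hj.symm]
    · simp
  have h2 : symUnit p = ∑ i : Fin 2, (1 / 2 : ℝ) •
      (![Matrix.single p.1 p.2 (1 : ℝ), Matrix.single p.2 p.1 1] i) := by
    rw [Fin.sum_univ_two, symUnit, smul_add]; rfl
  rw [h2, quadForm_sum_smul, Fin.sum_univ_two]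
  simp only [Matrix.cons_val_zero, Matrix.cons_val_one, h]
  rw [mul_comm (x p.2), ← add_smul]
  norm_num

theorem sum_quadForm_symUnit_sq (x : Fin n → R) :
    ∑ p, quadForm (symUnit p) x ^ 2 = (∑ i, x i ^ 2) ^ 2 := by
  simp only [quadForm_symUnit]
  rw [sq (∑ i, x i ^ 2), Finset.sum_mul_sum, Fintype.sum_prod_type]
  simp only [mul_pow]

end QuadForm

/-! ### From operator bounds to sum-of-squares certificates. -/

section Certificate

open Matrix

variable {n : ℕ}

/-- The symmetrised `i`-th slice of the sign tensor `e`. -/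
noncomputable def signSlice (e : Fin n × (Fin n × Fin n) → ℤˣ) (i : Fin n) :
    Matrix (Fin n) (Fin n) ℝ :=
  signedSum symUnit e i

/-- The centred sum of the squares of the slices of `e`, acting on `(ℝⁿ)^{⊗ l}`. -/
noncomputable def sliceOperator (l : ℕ) (e : Fin n × (Fin n × Fin n) → ℤˣ) :
    Matrix (Fin l → Fin n) (Fin l → Fin n) ℝ :=
  centredSquares (fun p => tensorLift l (symUnit p)) e

theorem signSlice_isSymm (e : Fin n × (Fin n × Fin n) → ℤˣ) (i : Fin n) :
    (signSlice e i).IsSymm :=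
  signedSum_isSymm symUnit_isSymm e i

theorem sliceOperator_isSymm (l : ℕ) (e : Fin n × (Fin n × Fin n) → ℤˣ) :
    (sliceOperator l e).IsSymm :=
  centredSquares_isSymm (fun p => tensorLift_isSymm (symUnit_isSymm p)) e

theorem sliceOperator_eq (l : ℕ) (e : Fin n × (Fin n × Fin n) → ℤˣ) :
    sliceOperator l e = ∑ i, tensorLift l (signSlice e i) * tensorLift l (signSlice e i)
      - (n : ℝ) • ∑ p, tensorLift l (symUnit p) * tensorLift l (symUnit p) := by
  have : ∀ i, signedSum (fun p => tensorLift l (symUnit p)) e i = tensorLift l (signSlice e i) :=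
    fun i => (tensorLift_sum_smul _ _ _).symm
  simp only [sliceOperator, centredSquares, this, Fintype.card_fin]

theorem quadForm_signSlice {R : Type*} [CommRing R] [Algebra ℝ R]
    (e : Fin n × (Fin n × Fin n) → ℤˣ) (i : Fin n) (x : Fin n → R) :
    quadForm (signSlice e i) x = ∑ p : Fin n × Fin n, signVal (e (i, p)) • (x p.1 * x p.2) := by
  rw [signSlice, signedSum, quadForm_sum_smul]
  simp only [quadForm_symUnit]

/-- The terms in `|B_i x|²`, with their mean, are exactly the form of the operator at `l = 1`, where
the coefficient `l(l-1)` vanishes; so no separate random estimate is needed for them. -/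
theorem tensorForm_sliceOperator {R : Type*} [CommRing R] [Algebra ℝ R] (l : ℕ)
    (e : Fin n × (Fin n × Fin n) → ℤˣ) (x : Fin n → R) :
    tensorForm (sliceOperator l e) x =
      ((l * (l - 1) : ℕ) : R) * ((∑ i, quadForm (signSlice e i) x ^ 2
        - (n : ℝ) • (∑ i, x i ^ 2) ^ 2) * (∑ i, x i ^ 2) ^ (l - 2))
      + (l : R) * (tensorForm (sliceOperator 1 e) x * (∑ i, x i ^ 2) ^ (l - 1)) := by
  have h : ∀ l, tensorForm (sliceOperator l e) x =
      ((l * (l - 1) : ℕ) : R) * ((∑ i, quadForm (signSlice e i) x ^ 2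
        - (n : ℝ) • (∑ i, x i ^ 2) ^ 2) * (∑ i, x i ^ 2) ^ (l - 2))
      + (l : R) * ((∑ i, (∑ j, (∑ k, signSlice e i j k • x k) ^ 2)
        - (n : ℝ) • ∑ p, ∑ j, (∑ k, symUnit p j k • x k) ^ 2) * (∑ i, x i ^ 2) ^ (l - 1)) := by
    intro l
    rw [sliceOperator_eq, tensorForm_sub, tensorForm_smul, tensorForm_sum, tensorForm_sum,
      ← sum_quadForm_symUnit_sq]
    simp only [tensorForm_tensorLift_mul_self (signSlice_isSymm e _),
      tensorForm_tensorLift_mul_self (symUnit_isSymm _), Finset.sum_add_distrib, ← Finset.mul_sum,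
      ← Finset.sum_mul, sub_mul, mul_sub, smul_add, smul_mul_assoc, mul_smul_comm, quadForm]
    ring
  rw [h l, h 1]
  simp

-- A positive semidefinite matrix is the square of a symmetric `D`, so its form at `x^{⊗ l}` is a
-- sum of squares of forms of degree `l`.
open MvPolynomial in
theorem IsPseudoMoment.tensorForm_nonneg {N : ℕ} {L : MvPolynomial (Fin n) ℝ →ₗ[ℝ] ℝ}
    (hL : IsPseudoMoment N L) {l : ℕ} {M : Matrix (Fin l → Fin n) (Fin l → Fin n) ℝ}
    (hM : M.IsSymm) (hpsd : ∀ v, 0 ≤ (M *ᵥ v) ⬝ᵥ v) {j : ℕ} {w : MvPolynomial (Fin n) ℝ}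
    (hw : w.totalDegree + l + j ≤ N) :
    0 ≤ L (normSqPoly n ^ j * w ^ 2 * tensorForm M X) := by
  obtain ⟨U, k, h1, h2, rfl⟩ := hM.exists_orthogonal_diagonalization
  have hk : ∀ t, 0 ≤ k t := by
    intro t
    have h := hpsd (U *ᵥ Pi.single t 1)
    rw [Matrix.mulVec_dotProduct_of_orthogonal_diagonalization, Matrix.mulVec_mulVec, h1,
      Matrix.one_mulVec, Finset.sum_eq_single t] at h
    · simpa using h
    · intro b _ hb; simp [hb]
    · simp
  set D := U * diagonal (fun t => Real.sqrt (k t)) * Uᵀ with hD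
  have hDs : D.IsSymm := by
    rw [Matrix.IsSymm, hD, Matrix.transpose_mul, Matrix.transpose_mul, Matrix.transpose_transpose,
      Matrix.diagonal_transpose, Matrix.mul_assoc]
  have hDD : U * diagonal k * Uᵀ = D * D := by
    rw [← sq, hD, Matrix.pow_of_orthogonal_diagonalization h1 h2]
    simp only [Real.sq_sqrt (hk _)]
  rw [hDD, tensorForm_mul_self hDs, Finset.mul_sum, map_sum]
  refine Finset.sum_nonneg fun t _ => ?_
  rw [mul_assoc, ← mul_pow]
  refine hL.normSq_pow_mul_sq_nonneg ?_
  have e1 : (∑ t', D t t' • tensorMonomial (X : Fin n → MvPolynomial (Fin n) ℝ) t').totalDegree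
      ≤ l := totalDegree_finsetSum_le fun t' _ =>
    (totalDegree_smul_le _ _).trans (totalDegree_tensorMonomial_le t')
  have e2 := totalDegree_mul w
    (∑ t', D t t' • tensorMonomial (X : Fin n → MvPolynomial (Fin n) ℝ) t')
  omega

open MvPolynomial in
/-- Bounds on the slice operators on `ℝⁿ` and on `(ℝⁿ)^{⊗ l}` bound the pseudo-moments of the sum
of the squares of the slices. -/
theorem IsPseudoMoment.sum_quadForm_sq_mul_le {N : ℕ} {L : MvPolynomial (Fin n) ℝ →ₗ[ℝ] ℝ}
    (hL : IsPseudoMoment N L) (e : Fin n × (Fin n × Fin n) → ℤˣ) {l : ℕ} (hl : 2 ≤ l) {R₁ R : ℝ}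
    (hR₁ : ∀ v, |(sliceOperator 1 e *ᵥ v) ⬝ᵥ v| ≤ R₁ * (v ⬝ᵥ v))
    (hR : ∀ v, |(sliceOperator l e *ᵥ v) ⬝ᵥ v| ≤ R * (v ⬝ᵥ v))
    {w : MvPolynomial (Fin n) ℝ} (hw : w.totalDegree + l ≤ N) :
    (l * (l - 1) : ℝ) * L ((∑ i, quadForm (signSlice e i) X ^ 2) *
      (normSqPoly n ^ (l - 2) * w ^ 2)) ≤
      (R + l * R₁ + n * (l * (l - 1))) * L (normSqPoly n ^ l * w ^ 2) := by
  set u := normSqPoly n with hu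
  set F : MvPolynomial (Fin n) ℝ := ∑ i, quadForm (signSlice e i) X ^ 2 with hF
  set k₁ : MvPolynomial (Fin n) ℝ := tensorForm (sliceOperator 1 e) X with hk₁
  have hsymm : ∀ (m : ℕ) (c r : ℝ), (r • (1 : Matrix (Fin m → Fin n) (Fin m → Fin n) ℝ)
      + c • sliceOperator m e).IsSymm := by
    intro m c r
    rw [Matrix.IsSymm, Matrix.transpose_add, Matrix.transpose_smul, Matrix.transpose_smul,
      Matrix.transpose_one, (sliceOperator_isSymm m e).eq]
  have hquad : ∀ (m : ℕ) (c r : ℝ) (v : (Fin m → Fin n) → ℝ),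
      ((r • (1 : Matrix (Fin m → Fin n) (Fin m → Fin n) ℝ) + c • sliceOperator m e) *ᵥ v) ⬝ᵥ v
        = r * (v ⬝ᵥ v) + c * ((sliceOperator m e *ᵥ v) ⬝ᵥ v) := by
    intro m c r v
    rw [Matrix.add_mulVec, Matrix.smul_mulVec, Matrix.smul_mulVec, Matrix.one_mulVec,
      add_dotProduct, smul_dotProduct, smul_dotProduct, smul_eq_mul, smul_eq_mul]
  have hform : ∀ (m : ℕ) (c r : ℝ), (tensorForm (r • (1 : Matrix (Fin m → Fin n) (Fin m → Fin n) ℝ)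
      + c • sliceOperator m e) X : MvPolynomial (Fin n) ℝ)
        = r • u ^ m + c • tensorForm (sliceOperator m e) X := by
    intro m c r
    rw [← sub_neg_eq_add, ← neg_smul, tensorForm_sub, tensorForm_smul, tensorForm_smul,
      tensorForm_one, neg_smul, sub_neg_eq_add]
    rfl
  -- The certificate uses `R - K_l ≥ 0` on `(ℝⁿ)^{⊗ l}` and `R₁ + K_1 ≥ 0` on `ℝⁿ`: solving for `∑
  -- Q_i²` puts a minus sign in front of the form of `K_1`.
  have c1 := hL.tensorForm_nonneg (hsymm l (-1) R) (fun v => by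
    rw [hquad]
    have := (abs_le.1 (hR v)).2
    linarith) (j := 0) (w := w) (by omega)
  have c2 := hL.tensorForm_nonneg (hsymm 1 1 R₁) (fun v => by
    rw [hquad]
    have := (abs_le.1 (hR₁ v)).1
    linarith) (j := l - 1) (w := w) (by omega)
  rw [hform, tensorForm_sliceOperator, ← hk₁] at c1
  rw [hform, ← hk₁, pow_one, one_smul] at c2
  have hul : u ^ l = u ^ (l - 1) * u := by rw [← pow_succ]; congr 1; omega
  have hul2 : u ^ l = u ^ (l - 2) * u ^ 2 := by rw [← pow_add]; congr 1; omega
  have key : (R + l * R₁ + n * (l * (l - 1)) : ℝ) • (u ^ l * w ^ 2)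
      - (l * (l - 1) : ℝ) • (F * (u ^ (l - 2) * w ^ 2))
      = u ^ 0 * w ^ 2 * (R • u ^ l + (-1 : ℝ) • (((l * (l - 1) : ℕ) : MvPolynomial (Fin n) ℝ) *
        ((F - (n : ℝ) • u ^ 2) * u ^ (l - 2)) + (l : MvPolynomial (Fin n) ℝ) * (k₁ * u ^ (l - 1))))
        + (l : ℝ) • (u ^ (l - 1) * w ^ 2 * (R₁ • u + k₁)) := by
    have hcast : ((l - 1 : ℕ) : MvPolynomial (Fin n) ℝ) = (l : MvPolynomial (Fin n) ℝ) - 1 := by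
      rw [Nat.cast_sub (by omega)]; simp
    simp only [smul_eq_C_mul, C_add, C_mul, C_sub, C_neg, C_1, map_natCast, Nat.cast_mul, hcast]
    have e1 : C R₁ * u ^ l = C R₁ * (u ^ (l - 1) * u) := by rw [← hul]
    have e2 : (n : MvPolynomial (Fin n) ℝ) * u ^ l = n * (u ^ (l - 2) * u ^ 2) := by rw [← hul2]
    linear_combination (l * w ^ 2) * e1 + (l * (l - 1) * w ^ 2) * e2
  have := congrArg L key
  rw [map_sub, map_add, map_smul, map_smul, map_smul] at this
  have c3 : 0 ≤ (l : ℝ) • L (u ^ (l - 1) * w ^ 2 * (R₁ • u + k₁)) :=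
    smul_nonneg (by positivity) c2
  have c1' := c1
  rw [← sub_nonneg]
  simp only [smul_eq_mul] at this c3
  rw [this]
  exact add_nonneg c1' c3

end Certificate

/-! ### High-probability norm bounds for the slice operators. -/

section SliceOperatorBound

open Matrix

variable {n : ℕ}

/-- The bound on the slice operator on `(ℝⁿ)^{⊗ l}` which holds with high probability. -/
noncomputable def sliceBound (n l : ℕ) : ℝ := 4 * (1536 * Real.log n * Real.sqrt (n * l) ^ 3)

theorem one_le_log_of_four_le (hn : 4 ≤ n) : 1 ≤ Real.log n := by
  have h : Real.log 4 ≤ Real.log n := Real.log_le_log (by norm_num) (by exact_mod_cast hn)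
  have h2 : Real.log 4 = 2 * Real.log 2 := by
    rw [show (4 : ℝ) = 2 ^ 2 by norm_num, Real.log_pow]; norm_num
  have := Real.log_two_gt_d9
  linarith

open Classical in
theorem card_not_sliceOperator_le (hn : 4 ≤ n) {l : ℕ} (hl : 1 ≤ l) (hln : l ≤ n) :
    ((Finset.univ.filter fun e : Fin n × (Fin n × Fin n) → ℤˣ =>
      ¬ ∀ v, |(sliceOperator l e *ᵥ v) ⬝ᵥ v| ≤ sliceBound n l * (v ⬝ᵥ v)).card : ℝ) * n ^ 3 ≤
      Fintype.card (Fin n × (Fin n × Fin n) → ℤˣ) := by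
  set g := Real.log n with hg
  have hg1 : 1 ≤ g := one_le_log_of_four_le hn
  have hn0 : (0 : ℝ) < n := by exact_mod_cast (by omega : 0 < n)
  have hl1 : (1 : ℝ) ≤ l := by exact_mod_cast hl
  have hln' : (l : ℝ) ≤ n := by exact_mod_cast hln
  -- The moment order `m + 1 = lK` makes `4^{m+1} ≥ n^{3l}`. This exceeds the dimension `n^l` and
  -- also yields a failure probability of at most `n^{-3}`.
  set K := ⌈3 * g⌉₊ with hK
  have hK1 : 3 * g ≤ K := Nat.le_ceil _
  have hK2 : (K : ℝ) ≤ 4 * g := by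
    have := Nat.ceil_lt_add_one (a := 3 * g) (by linarith)
    linarith
  have hKpos : 0 < K := by
    have : (0 : ℝ) < K := by linarith
    exact_mod_cast this
  obtain ⟨m, hm⟩ : ∃ m, m + 1 = l * K := ⟨l * K - 1, by have := Nat.mul_pos hl hKpos; omega⟩
  have hmr : (m : ℝ) + 1 = l * K := by exact_mod_cast hm
  have h4 : ((n : ℝ) ^ 3) ^ l ≤ 4 ^ (m + 1) := by
    have h1 : (n : ℝ) ^ 3 ≤ 4 ^ K := by
      have e1 : (n : ℝ) ^ 3 = Real.exp (3 * g) := by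
        rw [hg, show (3 : ℝ) * Real.log n = ((3 : ℕ) : ℝ) * Real.log n by norm_num,
          Real.exp_nat_mul, Real.exp_log hn0]
      rw [e1]
      calc Real.exp (3 * g) ≤ Real.exp (K * 1) := Real.exp_le_exp.2 (by linarith)
        _ = Real.exp 1 ^ K := Real.exp_nat_mul _ _
        _ ≤ 4 ^ K := by
          gcongr
          have := Real.exp_one_lt_d9
          linarith
    calc ((n : ℝ) ^ 3) ^ l ≤ (4 ^ K) ^ l := by gcongr
      _ = 4 ^ (m + 1) := by rw [← pow_mul, hm, mul_comm]
  have h1n : (1 : ℝ) ≤ n := by linarith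
  have hn3 : (n : ℝ) ^ 3 ≤ 4 ^ (m + 1) :=
    (le_self_pow₀ (one_le_pow₀ h1n) (by omega)).trans h4
  have hT : (Fintype.card (Fin l → Fin n) : ℝ) ≤ 4 ^ (m + 1) := by
    rw [Fintype.card_fun, Fintype.card_fin, Fintype.card_fin]
    push_cast
    refine le_trans ?_ h4
    gcongr
    exact le_self_pow₀ h1n (by norm_num)
  set y := Real.sqrt (n * l) with hy
  have hy2 : y ^ 2 = n * l := Real.sq_sqrt (by positivity)
  have hy0 : 0 < y := Real.sqrt_pos.2 (by positivity)
  have hly : (l : ℝ) ≤ y := by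
    rw [hy]; exact Real.le_sqrt_of_sq_le (by nlinarith)
  -- `1536 = 192 · 4 · 2`, from `m + 1 ≤ 4gl`, `l ≤ y` and `σ ≤ 2y²`. The variance condition needs
  -- only `2304 g y⁶ ≤ τ²`, which has room to spare as `g ≥ 1`.
  set τ := 1536 * g * y ^ 3 with hτ
  have hτ0 : 0 < τ := by positivity
  have hσ2 : (n * l + l ^ 2 : ℝ) ≤ 2 * y ^ 2 := by rw [hy2]; nlinarith
  have hp : (m : ℝ) + 1 ≤ 4 * g * l := by rw [hmr]; nlinarith
  have key := card_not_abs_centredSquares_le (ι := Fin n) (τ := τ)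
    (E := fun p : Fin n × Fin n => tensorLift l (symUnit p))
    (fun p => tensorLift_isSymm (symUnit_isSymm p)) (σ := n * l + l ^ 2) (by positivity)
    (fun v => sum_tensorLift_symUnit_le v) m hT hτ0 (by
      calc 192 * ((m : ℝ) + 1) * (n * l + l ^ 2) ≤ 192 * (4 * g * y) * (2 * y ^ 2) := by
            gcongr
            exact hp.trans (by gcongr)
        _ = τ := by rw [hτ]; ring) (by
      rw [Fintype.card_fin]
      calc 144 * ((m : ℝ) + 1) * n * (n * l + l ^ 2) ^ 2
          ≤ 144 * (4 * g * l) * n * (2 * y ^ 2) ^ 2 := by gcongr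
        _ = 2304 * g * y ^ 6 := by
            have : 144 * (4 * g * l) * n * (2 * y ^ 2) ^ 2 = 2304 * g * (n * l) * y ^ 4 := by ring
            rw [this, ← hy2]; ring
        _ ≤ 2304 * (g * g) * y ^ 6 := by gcongr; nlinarith
        _ ≤ 1536 ^ 2 * (g * g) * y ^ 6 := by gcongr; norm_num
        _ = τ ^ 2 := by rw [hτ]; ring)
    (Finset.univ.filter fun e : Fin n × (Fin n × Fin n) → ℤˣ =>
      ¬ ∀ v, |(sliceOperator l e *ᵥ v) ⬝ᵥ v| ≤ sliceBound n l * (v ⬝ᵥ v)) (by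
      intro e he
      exact (Finset.mem_filter.1 he).2)
  exact (mul_le_mul_of_nonneg_left hn3 (by positivity)).trans key

/-- For all but a `1/n` fraction of sign patterns, all slice operators are bounded. -/
theorem exists_finset_sliceOperator_bounded (hn : 4 ≤ n) {N : ℕ} (hN : N ≤ n) :
    ∃ S : Finset (Fin n × (Fin n × Fin n) → ℤˣ),
      (1 - (n : ℝ)⁻¹) * Fintype.card (Fin n × (Fin n × Fin n) → ℤˣ) ≤ S.card ∧
      ∀ e ∈ S, ∀ l, 1 ≤ l → l ≤ N →
        ∀ v, |(sliceOperator l e *ᵥ v) ⬝ᵥ v| ≤ sliceBound n l * (v ⬝ᵥ v) := by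
  classical
  set good := Finset.univ.filter fun e : Fin n × (Fin n × Fin n) → ℤˣ => ∀ l, 1 ≤ l → l ≤ N →
      ∀ v, |(sliceOperator l e *ᵥ v) ⬝ᵥ v| ≤ sliceBound n l * (v ⬝ᵥ v) with hgood
  refine ⟨good, ?_, fun e he => by
    simpa only [hgood, Finset.mem_filter, Finset.mem_univ, true_and] using he⟩
  set bad : ℕ → Finset (Fin n × (Fin n × Fin n) → ℤˣ) := fun l => Finset.univ.filter fun e =>
      ¬ ∀ v, |(sliceOperator l e *ᵥ v) ⬝ᵥ v| ≤ sliceBound n l * (v ⬝ᵥ v) with hbad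
  set c : ℝ := (Fintype.card (Fin n × (Fin n × Fin n) → ℤˣ) : ℝ) with hc
  have hn0 : (0 : ℝ) < n := by exact_mod_cast (by omega : 0 < n)
  have hcover : goodᶜ ⊆ (Finset.Icc 1 N).biUnion bad := by
    intro e he
    simp only [hgood, Finset.mem_compl, Finset.mem_filter, Finset.mem_univ, true_and] at he
    push Not at he
    obtain ⟨l, h1, h2, v, hv⟩ := he
    refine Finset.mem_biUnion.2 ⟨l, Finset.mem_Icc.2 ⟨h1, h2⟩, ?_⟩
    simp only [hbad, Finset.mem_filter, Finset.mem_univ, true_and]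
    exact fun h => absurd (h v) (not_le.2 hv)
  have h1 : (goodᶜ.card : ℝ) ≤ ∑ l ∈ Finset.Icc 1 N, ((bad l).card : ℝ) := by
    exact_mod_cast (Finset.card_le_card hcover).trans Finset.card_biUnion_le
  have h2 : ∀ l ∈ Finset.Icc 1 N, ((bad l).card : ℝ) ≤ c / n ^ 3 := by
    intro l hl
    rw [Finset.mem_Icc] at hl
    rw [le_div_iff₀ (by positivity)]
    convert card_not_sliceOperator_le hn hl.1 (hl.2.trans hN)
  have h3 := h1.trans (Finset.sum_le_sum h2)
  rw [Finset.sum_const, Nat.card_Icc, Nat.add_sub_cancel, nsmul_eq_mul] at h3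
  -- The union over at most `n` values of `l` costs one factor `n`; one more is given away.
  have h4 : (N : ℝ) * (c / n ^ 3) ≤ (n : ℝ)⁻¹ * c := by
    have hNn : (N : ℝ) ≤ n := by exact_mod_cast hN
    have h1n : (1 : ℝ) ≤ n := by exact_mod_cast (by omega : 1 ≤ n)
    have hc0 : 0 ≤ c := by positivity
    calc (N : ℝ) * (c / n ^ 3) ≤ n * (c / n ^ 3) := by gcongr
      _ = (n : ℝ)⁻¹ * c * (n : ℝ)⁻¹ := by field_simp
      _ ≤ (n : ℝ)⁻¹ * c * 1 := by
          gcongr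
          exact inv_le_one_of_one_le₀ h1n
      _ = _ := mul_one _
  have h5 : (goodᶜ.card : ℝ) = c - good.card := by
    rw [Finset.card_compl, Nat.cast_sub (Finset.card_le_univ _)]
  linarith

end SliceOperatorBound

/-! ### The bound on pseudo-moments of the cubic form. -/

section PseudoMomentBound

open MvPolynomial

variable {n : ℕ}

/-- If the slice operators of the sign tensor `e` are bounded, then so are all pseudo-moments of
the cubic form of `e`. -/
theorem IsPseudoMoment.cubic_le {N : ℕ} {L : MvPolynomial (Fin n) ℝ →ₗ[ℝ] ℝ}
    (hL : IsPseudoMoment N L) (hn : 4 ≤ n) (hN2 : 2 ≤ N) (hNn : N ≤ n)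
    (e : Fin n × (Fin n × Fin n) → ℤˣ)
    (he : ∀ l, 1 ≤ l → l ≤ N → ∀ v, |dotProduct ((sliceOperator l e).mulVec v) v| ≤
      sliceBound n l * dotProduct v v) :
    L (∑ i, X i * quadForm (signSlice e i) X) ≤
      Real.sqrt (16 * (25000 * Real.log n * Real.sqrt n ^ 3) / Real.sqrt ((N / 2 : ℕ) : ℝ)) := by
  set g := Real.log n with hg
  have hg1 : 1 ≤ g := one_le_log_of_four_le hn
  have hn0 : (0 : ℝ) < n := by exact_mod_cast (by omega : 0 < n)
  set z := Real.sqrt n with hz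
  have hz0 : 0 < z := Real.sqrt_pos.2 hn0
  have hz2 : z ^ 2 = n := Real.sq_sqrt hn0.le
  set Λ := 25000 * g * z ^ 3 with hΛ
  have hΛ0 : 0 < Λ := by positivity
  set Q : Fin n → MvPolynomial (Fin n) ℝ := fun i => quadForm (signSlice e i) X with hQ
  have hQ2 : ∀ i, (Q i).totalDegree ≤ 2 := by
    intro i
    rw [hQ]
    simp only [quadForm_signSlice]
    refine totalDegree_finsetSum_le fun p _ => (totalDegree_smul_le _ _).trans
      ((totalDegree_mul _ _).trans ?_)
    simp [totalDegree_X]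
  -- The largest `d` with `2d + 2 ≤ N`, the degree budget of the norm-removal argument.
  obtain ⟨d, hd⟩ : ∃ d, d + 1 = N / 2 := ⟨N / 2 - 1, by omega⟩
  have hF : L (∑ i, Q i ^ 2) ≤ 16 * Λ / Real.sqrt (d + 1) := by
    refine hL.le_of_forall_normSq_pow_mul_le Q hQ2 (by omega) hΛ0.le fun k w hw => ?_
    have h1 := hL.sum_quadForm_sq_mul_le e (l := k + 2) (by omega) (he 1 le_rfl (by omega))
      (he (k + 2) (by omega) (by omega)) hw
    have hpos : 0 ≤ L (normSqPoly n ^ (k + 2) * w ^ 2) := hL.normSq_pow_mul_sq_nonneg hw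
    rw [Nat.add_sub_cancel] at h1
    set a : ℝ := ((k + 2 : ℕ) : ℝ) with ha
    have ha2 : 2 ≤ a := by rw [ha]; push_cast; have : (0 : ℝ) ≤ k := by positivity
                           linarith
    have haa : 0 < a * (a - 1) := by nlinarith
    set s := Real.sqrt a with hs
    have hs0 : 0 < s := Real.sqrt_pos.2 (by linarith)
    have hs2 : s ^ 2 = a := Real.sq_sqrt (by linarith)
    have hs1 : 1 ≤ s := by rw [hs, Real.one_le_sqrt]; linarith
    have hsz : s ≤ z := by
      apply Real.sqrt_le_sqrt
      rw [ha]; exact_mod_cast (by omega : k + 2 ≤ n)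
    have hB : sliceBound n (k + 2) = 6144 * g * (z * s) ^ 3 := by
      rw [sliceBound, ← ha, Real.sqrt_mul hn0.le]; ring
    have hB1 : sliceBound n 1 = 6144 * g * z ^ 3 := by
      rw [sliceBound, Nat.cast_one, mul_one]; ring
    -- With `l = a = s²`, each of the two operator bounds costs at most `2 · 6144` units of `g z³ s
    -- (a - 1)` and the mean at most one, since `s ≤ z`; the total `24577` is rounded up to `25000`.
    have h2 : sliceBound n (k + 2) + a * sliceBound n 1 + n * (a * (a - 1)) ≤
        a * (a - 1) * (Λ * (1 / s)) := by
      rw [hB, hB1, hΛ]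
      have e1 : a * (a - 1) * (25000 * g * z ^ 3 * (1 / s)) = 25000 * g * z ^ 3 * s * (a - 1) := by
        rw [← hs2]; field_simp
      have e2 : (z * s) ^ 3 ≤ 2 * (z ^ 3 * s * (a - 1)) := by
        have : (z * s) ^ 3 = z ^ 3 * s * a := by rw [← hs2]; ring
        rw [this]
        have : 0 ≤ z ^ 3 * s := by positivity
        nlinarith
      have e3 : a * z ^ 3 ≤ 2 * (z ^ 3 * s * (a - 1)) := by
        have h3 : 0 ≤ z ^ 3 := by positivity
        have h4 : a ≤ 2 * (s * (a - 1)) := by nlinarith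
        nlinarith
      have e4 : n * (a * (a - 1)) ≤ g * (z ^ 3 * s * (a - 1)) := by
        have h4 : (n : ℝ) * a ≤ z ^ 3 * s := by
          rw [← hz2, ← hs2]
          calc z ^ 2 * s ^ 2 = z ^ 2 * s * s := by ring
            _ ≤ z ^ 2 * s * z := by gcongr
            _ = _ := by ring
        have h5 : 0 ≤ z ^ 3 * s * (a - 1) := mul_nonneg (by positivity) (by linarith)
        calc n * (a * (a - 1)) = n * a * (a - 1) := by ring
          _ ≤ z ^ 3 * s * (a - 1) := mul_le_mul_of_nonneg_right h4 (by linarith)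
          _ ≤ _ := by nlinarith
      have h5 : 0 ≤ g * (z ^ 3 * s * (a - 1)) :=
        mul_nonneg (by linarith) (mul_nonneg (by positivity) (by linarith))
      have e2' := mul_le_mul_of_nonneg_left e2 (by positivity : 0 ≤ 6144 * g)
      have e3' := mul_le_mul_of_nonneg_left e3 (by positivity : 0 ≤ 6144 * g)
      rw [e1]
      nlinarith
    have h3 : L ((∑ i, Q i ^ 2) * (normSqPoly n ^ k * w ^ 2)) ≤
        Λ * (1 / s) * L (normSqPoly n ^ (k + 2) * w ^ 2) := by
      have := h1.trans (mul_le_mul_of_nonneg_right h2 hpos)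
      rw [mul_assoc (a * (a - 1))] at this
      exact le_of_mul_le_mul_left this haa
    refine h3.trans (mul_le_mul_of_nonneg_right ?_ hpos)
    refine mul_le_mul_of_nonneg_left ?_ hΛ0.le
    have : Real.sqrt ((k : ℝ) + 1) ≤ s := by
      apply Real.sqrt_le_sqrt
      rw [ha]; push_cast; linarith
    exact one_div_le_one_div_of_le (Real.sqrt_pos.2 (by positivity)) this
  have hdN : ((N / 2 : ℕ) : ℝ) = d + 1 := by rw [← hd]; push_cast; ring
  rw [hdN]
  set B := 16 * Λ / Real.sqrt (d + 1) with hB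
  have hB0 : 0 < B := by positivity
  set c := Real.sqrt B with hc
  have hc0 : 0 < c := Real.sqrt_pos.2 hB0
  have hc2 : c ^ 2 = B := Real.sq_sqrt hB0.le
  -- Cauchy–Schwarz with the optimal multiplier `c = √B`, using `L (‖x‖²) ≤ 1`.
  have hcs : 0 ≤ L (∑ i, (c • X i - Q i) ^ 2) := by
    rw [map_sum]
    refine Finset.sum_nonneg fun i _ => hL.sq_nonneg _ ((totalDegree_sub _ _).trans
      (max_le ((totalDegree_smul_le _ _).trans ?_) ((hQ2 i).trans hN2)))
    rw [totalDegree_X]; omega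
  have hexp : ∑ i, (c • X i - Q i) ^ 2
      = c ^ 2 • normSqPoly n - (2 * c) • ∑ i, X i * Q i + ∑ i, Q i ^ 2 := by
    rw [normSqPoly, Finset.smul_sum, Finset.smul_sum, ← Finset.sum_sub_distrib,
      ← Finset.sum_add_distrib]
    refine Finset.sum_congr rfl fun i _ => ?_
    simp only [smul_eq_C_mul, C_mul, C_pow, map_ofNat]
    ring
  rw [hexp, map_add, map_sub, map_smul, map_smul, smul_eq_mul, smul_eq_mul] at hcs
  have hu : L (normSqPoly n) ≤ 1 := by
    have := hL.map_normSq_pow_le_one (j := 1) one_pos (by omega)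
    rwa [pow_one] at this
  have h6 : 2 * c * L (∑ i, X i * Q i) ≤ 2 * c * c := by
    have : c ^ 2 * L (normSqPoly n) ≤ c ^ 2 * 1 := mul_le_mul_of_nonneg_left hu (by positivity)
    nlinarith
  exact le_of_mul_le_mul_left h6 (by positivity)

end PseudoMomentBound

/-! ### A lower bound for the maximum of a sign cubic on the sphere. -/

section PolyMax

variable {n : ℕ}

/-- Three-index families as pairs of an index and a pair of indices. -/
def finThreeArrowEquiv (α : Type*) : (Fin 3 → α) ≃ α × (α × α) where
  toFun I := (I 0, (I 1, I 2))
  invFun p := ![p.1, p.2.1, p.2.2]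
  left_inv I := by ext i; fin_cases i <;> rfl
  right_inv p := rfl

theorem sum_fin_three_arrow {β : Type*} [AddCommMonoid β] (f : Fin n → Fin n → Fin n → β) :
    ∑ I : Fin 3 → Fin n, f (I 0) (I 1) (I 2) = ∑ i, ∑ j, ∑ k, f i j k := by
  rw [← Equiv.sum_comp (finThreeArrowEquiv (Fin n)).symm, Fintype.sum_prod_type]
  refine Finset.sum_congr rfl fun i _ => ?_
  rw [Fintype.sum_prod_type]
  rfl

/-- The tensor with the sign pattern `e`. -/
def signTensor (e : Fin n × (Fin n × Fin n) → ℤˣ) : RealTensor 3 n :=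
  fun I => signVal (e (finThreeArrowEquiv (Fin n) I))

theorem toPoly_signTensor (e : Fin n × (Fin n × Fin n) → ℤˣ) :
    (signTensor e).toPoly
      = ∑ i, MvPolynomial.X i * quadForm (signSlice e i) MvPolynomial.X := by
  unfold RealTensor.toPoly signTensor
  simp only [Fin.prod_univ_three, quadForm_signSlice]
  rw [← Equiv.sum_comp (finThreeArrowEquiv (Fin n)).symm, Fintype.sum_prod_type]
  refine Finset.sum_congr rfl fun i _ => ?_
  rw [Finset.mul_sum]
  refine Finset.sum_congr rfl fun p _ => ?_
  have h0 : (finThreeArrowEquiv (Fin n)).symm (i, p) 0 = i := rfl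
  have h1 : (finThreeArrowEquiv (Fin n)).symm (i, p) 1 = p.1 := rfl
  have h2 : (finThreeArrowEquiv (Fin n)).symm (i, p) 2 = p.2 := rfl
  rw [Equiv.apply_symm_apply, MvPolynomial.smul_eq_C_mul, h0, h1, h2]
  ring

theorem eval_toPoly_signTensor (e : Fin n × (Fin n × Fin n) → ℤˣ) (x : Fin n → ℝ) :
    MvPolynomial.eval x (signTensor e).toPoly
      = ∑ i, ∑ j, ∑ k, signVal (e (i, (j, k))) * (x i * x j * x k) := by
  rw [← sum_fin_three_arrow fun i j k => signVal (e (i, (j, k))) * (x i * x j * x k)]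
  simp only [RealTensor.toPoly, signTensor, Fin.prod_univ_three, map_sum, map_mul,
    MvPolynomial.eval_C, MvPolynomial.eval_X]
  rfl

theorem eval_le_polyMax (f : MvPolynomial (Fin n) ℝ) {x : Fin n → ℝ} (hx : ∑ i, x i ^ 2 = 1) :
    MvPolynomial.eval x f ≤ polyMax f := by
  have hset : {y : ℝ | ∃ x : EuclideanSpace ℝ (Fin n), ‖x‖ = 1 ∧
      MvPolynomial.eval (fun i => x i) f = y}
      = (fun x : EuclideanSpace ℝ (Fin n) => MvPolynomial.eval (fun i => x i) f) ''
        Metric.sphere 0 1 := by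
    ext y; simp
  refine le_csSup ?_ ⟨WithLp.toLp 2 x, ?_, rfl⟩
  · rw [hset]
    refine (isCompact_sphere 0 1).bddAbove_image (Continuous.continuousOn ?_)
    have h1 : Continuous fun x : EuclideanSpace ℝ (Fin n) => (fun i => x i : Fin n → ℝ) := by
      fun_prop
    exact (MvPolynomial.continuous_eval f).comp h1
  · rw [EuclideanSpace.norm_eq]
    simp [hx]

/-- A sum of three signs is odd, hence nonzero. -/
theorem one_le_abs_signVal_add (a b c : ℤˣ) : 1 ≤ |signVal a + signVal b + signVal c| := by
  rcases Int.units_eq_one_or a with rfl | rfl <;> rcases Int.units_eq_one_or b with rfl | rfl <;>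
    rcases Int.units_eq_one_or c with rfl | rfl <;> norm_num [signVal]

/-- The maximum on the sphere of a cubic form with `±1` coefficients is at least `√(n-1) / 3`. -/
theorem sqrt_le_three_mul_polyMax {m : ℕ} (hm : 1 ≤ m)
    (e : Fin (m + 1) × (Fin (m + 1) × Fin (m + 1)) → ℤˣ) :
    Real.sqrt m ≤ 3 * polyMax (signTensor e).toPoly := by
  set M := polyMax (signTensor e).toPoly with hM
  set T : (Fin (m + 1) → ℝ) → ℝ :=
    fun x => ∑ i, ∑ j, ∑ k, signVal (e (i, (j, k))) * (x i * x j * x k) with hT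
  have hTM : ∀ x : Fin (m + 1) → ℝ, ∑ i, x i ^ 2 = 1 → T x ≤ M := by
    intro x hx
    have := eval_le_polyMax (signTensor e).toPoly hx
    rwa [eval_toPoly_signTensor] at this
  have hmr : (0 : ℝ) < m := by exact_mod_cast hm
  set r := Real.sqrt m with hr
  have hr0 : 0 < r := Real.sqrt_pos.2 hmr
  have hr2 : r ^ 2 = m := Real.sq_sqrt hmr.le
  -- `b c` is the coefficient of `x_0² x_c` for `c ≠ 0`. The unit vector `v`, orthogonal to `ε =
  -- e_0`, takes its signs from `b`, so that `∑ v_c b_c ≥ √m`.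
  set b : Fin (m + 1) → ℝ := fun c =>
    signVal (e (0, (0, c))) + signVal (e (0, (c, 0))) + signVal (e (c, (0, 0))) with hb
  have hb1 : ∀ c, 1 ≤ |b c| := fun c => one_le_abs_signVal_add _ _ _
  have hsign : ∀ c, ∃ s : ℝ, s ^ 2 = 1 ∧ s * b c = |b c| := by
    intro c
    rcases le_total 0 (b c) with h | h
    · exact ⟨1, by norm_num, by rw [abs_of_nonneg h, one_mul]⟩
    · exact ⟨-1, by norm_num, by rw [abs_of_nonpos h]; ring⟩
  choose s hs1 hs2 using hsign
  set v : Fin (m + 1) → ℝ := Fin.cons 0 fun c => s c.succ / r with hv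
  have hv0 : v 0 = 0 := rfl
  have hvs : ∀ c : Fin m, v c.succ = s c.succ / r := fun c => rfl
  have hvn : ∑ i, v i ^ 2 = 1 := by
    rw [Fin.sum_univ_succ, hv0]
    simp only [hvs, div_pow, hs1, hr2]
    simp [hmr.ne']
  set ε : Fin (m + 1) → ℝ := Pi.single 0 1 with hε
  have hεv : ∀ i, ε i * v i = 0 := by
    intro i
    by_cases h : i = 0
    · rw [h, hv0, mul_zero]
    · rw [hε, Pi.single_eq_of_ne h, zero_mul]
  have hεn : ∑ i, ε i ^ 2 = 1 := by
    rw [Finset.sum_eq_single 0] <;> simp +contextual [hε]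
  set B := ∑ c, v c * b c with hB
  have hBr : r ≤ B := by
    rw [hB, Fin.sum_univ_succ, hv0, zero_mul, zero_add]
    have h1 : ∀ c : Fin m, 1 / r ≤ v c.succ * b c.succ := by
      intro c
      rw [hvs, div_mul_eq_mul_div, hs2]
      gcongr
      exact hb1 _
    calc r = ∑ _c : Fin m, 1 / r := by
          rw [Finset.sum_const, Finset.card_univ, Fintype.card_fin, nsmul_eq_mul, ← hr2]
          field_simp
      _ ≤ _ := Finset.sum_le_sum fun c _ => h1 c
  have hBT : ∑ i, ∑ j, ∑ k, signVal (e (i, (j, k))) *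
      (ε i * ε j * v k + ε i * v j * ε k + v i * ε j * ε k) = B := by
    simp only [mul_add, Finset.sum_add_distrib, hB, hb]
    have hsum : ∀ f : Fin (m + 1) → ℝ, ∑ i, ε i * f i = f 0 := by
      intro f
      rw [Finset.sum_eq_single 0] <;> simp +contextual [hε]
    congr 1
    · congr 1
      · calc _ = ∑ i, ε i * ∑ j, ε j * ∑ k, v k * signVal (e (i, (j, k))) := by
              simp only [Finset.mul_sum]
              refine Finset.sum_congr rfl fun i _ => Finset.sum_congr rfl fun j _ =>
                Finset.sum_congr rfl fun k _ => by ring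
          _ = _ := by rw [hsum, hsum]
      · calc _ = ∑ i, ε i * ∑ j, ∑ k, ε k * (v j * signVal (e (i, (j, k)))) := by
              simp only [Finset.mul_sum]
              refine Finset.sum_congr rfl fun i _ => Finset.sum_congr rfl fun j _ =>
                Finset.sum_congr rfl fun k _ => by ring
          _ = _ := by rw [hsum]; simp only [hsum]
    · calc _ = ∑ i, ∑ j, ε j * ∑ k, ε k * (v i * signVal (e (i, (j, k)))) := by
              simp only [Finset.mul_sum]
              refine Finset.sum_congr rfl fun i _ => Finset.sum_congr rfl fun j _ =>
                Finset.sum_congr rfl fun k _ => by ring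
        _ = _ := by simp only [hsum]
  have hnorm : ∀ a t : ℝ, a ^ 2 + t ^ 2 = 1 → ∑ i, (a * ε i + t * v i) ^ 2 = 1 := by
    intro a t h
    have : ∀ i, (a * ε i + t * v i) ^ 2 = a ^ 2 * ε i ^ 2 + t ^ 2 * v i ^ 2 := by
      intro i
      linear_combination (2 * a * t) * hεv i
    simp only [this, Finset.sum_add_distrib, ← Finset.mul_sum, hεn, hvn]
    linarith
  -- Averaging over `±a` keeps only the part even in `ε`. At `a = √3/2`, `t = 1/2` this gives `3B/4
  -- + T(v)/4 ≤ 2M`; together with `-T(v) ≤ M`, from the point `-v`, it follows that `B ≤ 3M`.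
  have hpair : ∀ a t : ℝ, T (fun i => a * ε i + t * v i) + T (fun i => -a * ε i + t * v i)
      = 2 * a ^ 2 * t * B + 2 * t ^ 3 * T v := by
    intro a t
    rw [← hBT]
    simp only [hT, Finset.mul_sum]
    simp only [← Finset.sum_add_distrib]
    refine Finset.sum_congr rfl fun i _ => Finset.sum_congr rfl fun j _ =>
      Finset.sum_congr rfl fun k _ => by ring
  have h3 : (Real.sqrt 3 / 2) ^ 2 = 3 / 4 := by
    rw [div_pow, Real.sq_sqrt (by norm_num)]; norm_num
  have p1 := hTM _ (hnorm (Real.sqrt 3 / 2) (1 / 2) (by rw [h3]; norm_num))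
  have p2 := hTM _ (hnorm (-(Real.sqrt 3 / 2)) (1 / 2) (by rw [neg_sq, h3]; norm_num))
  have p3 := hpair (Real.sqrt 3 / 2) (1 / 2)
  rw [h3] at p3
  have p4 : -T v ≤ M := by
    have h := hTM (fun i => -v i) (by simpa using hvn)
    have h2 : T (fun i => -v i) = -T v := by
      simp only [hT, ← Finset.sum_neg_distrib]
      refine Finset.sum_congr rfl fun i _ => Finset.sum_congr rfl fun j _ =>
        Finset.sum_congr rfl fun k _ => by ring
    rwa [h2] at h
  linarith

end PolyMax

/-! ### From pseudo-expectations to pseudo-moments. -/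

section PseudoExpectation

variable {n q : ℕ}

/-- An arbitrary linear extension to all polynomials removes the degree proofs from later
statements. Of the sphere constraint only the multiplier `p = 1` is used. -/
theorem IsPseudoExpectation.exists_isPseudoMoment {E : PolyLE n q →ₗ[ℝ] ℝ}
    (hE : IsPseudoExpectation E) (hS : RespectsEq E (sphereConstraint n q)) :
    ∃ L : MvPolynomial (Fin n) ℝ →ₗ[ℝ] ℝ, IsPseudoMoment (q / 2) L ∧ ∀ p, E p = L p := by
  obtain ⟨L, hL⟩ := LinearMap.exists_extend E
  have hLE : ∀ p, E p = L p := fun p => by rw [← hL]; rfl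
  refine ⟨L, ⟨?_, fun p hp => ?_, ?_⟩, hLE⟩
  · rw [← hE.map_one, hLE]
  · have := hE.sq_nonneg p hp
    rwa [hLE] at this
  · have hdeg : (normSqPoly n ^ (q / 2)).totalDegree ≤ q := by
      refine (MvPolynomial.totalDegree_pow _ _).trans ?_
      have := Nat.mul_le_mul_left (q / 2) (totalDegree_normSqPoly_le (n := n))
      omega
    have hmem : 1 * sphereConstraint n q ∈ PolyLE n q := by
      rw [one_mul]
      exact Submodule.sub_mem _ ((MvPolynomial.mem_restrictTotalDegree _ _ _).2 hdeg)
        (PolyLE.one_mem n q)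
    have h := hS 1 hmem
    rw [hLE] at h
    have h2 : L (normSqPoly n ^ (q / 2) - 1) = 0 := by
      change L (1 * sphereConstraint n q) = 0 at h
      rw [one_mul] at h
      exact h
    have h3 : L 1 = 1 := by rw [← hE.map_one, hLE]
    rw [map_sub, h3] at h2
    exact sub_eq_zero.1 h2

end PseudoExpectation

/-! ### The law of the random tensor as the uniform law on sign patterns. -/

section RademacherTensor

variable {Ω : Type*} [MeasurableSpace Ω] {P : Measure Ω} [IsProbabilityMeasure P] {n : ℕ}
  {A : Ω → RealTensor 3 n}

omit [IsProbabilityMeasure P] in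
theorem IsRademacherTensor.measureReal_eq_signTensor (hA : IsRademacherTensor P A)
    (e : Fin n × (Fin n × Fin n) → ℤˣ) :
    P.real {ω | A ω = signTensor e} =
      (Fintype.card (Fin n × (Fin n × Fin n) → ℤˣ) : ℝ)⁻¹ := by
  have hset : {ω | A ω = signTensor e}
      = ⋂ I ∈ (Finset.univ : Finset (Fin 3 → Fin n)), (fun ω => A ω I) ⁻¹' {signTensor e I} := by
    ext ω
    simp [funext_iff]
  have hone : ∀ I, P ((fun ω => A ω I) ⁻¹' {signTensor e I}) = 1 / 2 := by
    intro I
    unfold signTensor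
    rcases Int.units_eq_one_or (e (finThreeArrowEquiv (Fin n) I)) with h | h
    · rw [h]
      simpa [signVal, Set.preimage] using hA.prob_one I
    · rw [h]
      simpa [signVal, Set.preimage] using hA.prob_neg_one I
  rw [Measure.real, hset, hA.indep.measure_inter_preimage_eq_mul Finset.univ
    (fun I _ => measurableSet_singleton _)]
  simp only [hone, Finset.prod_const, Finset.card_univ]
  rw [Fintype.card_congr (finThreeArrowEquiv (Fin n)), ENNReal.toReal_pow, Fintype.card_fun,
    Fintype.card_units_int]
  simp

/-- The events `A = signTensor e` are disjoint, measurable and equally likely, so counting becomes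
probability. The set `G` need not be measurable, since only monotonicity is applied to it. -/
theorem IsRademacherTensor.card_div_card_le_measureReal (hA : IsRademacherTensor P A)
    (S : Finset (Fin n × (Fin n × Fin n) → ℤˣ)) {G : Set Ω}
    (hG : ∀ e ∈ S, ∀ ω, A ω = signTensor e → ω ∈ G) :
    (S.card : ℝ) / Fintype.card (Fin n × (Fin n × Fin n) → ℤˣ) ≤ P.real G := by
  have hmeas : ∀ e ∈ S, MeasurableSet {ω | A ω = signTensor e} := by
    intro e _
    have hset : {ω | A ω = signTensor e}
        = ⋂ I : Fin 3 → Fin n, (fun ω => A ω I) ⁻¹' {signTensor e I} := by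
      ext ω; simp [funext_iff]
    rw [hset]
    exact MeasurableSet.iInter fun I => hA.measurable_entry I (measurableSet_singleton _)
  have hinj : ∀ e e' : Fin n × (Fin n × Fin n) → ℤˣ, signTensor e = signTensor e' → e = e' := by
    intro e e' h
    funext a
    have := congrFun h ((finThreeArrowEquiv (Fin n)).symm a)
    simp only [signTensor, Equiv.apply_symm_apply, signVal, Int.cast_inj] at this
    exact Units.ext this
  have h1 := measureReal_biUnion_finset (μ := P) (s := S) (f := fun e => {ω | A ω = signTensor e})
    (by
      intro e _ e' _ hne
      refine Set.disjoint_left.2 fun ω (h : A ω = signTensor e) (h' : A ω = signTensor e') =>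
        hne (hinj e e' (h.symm.trans h'))) hmeas
  simp only [hA.measureReal_eq_signTensor, Finset.sum_const, nsmul_eq_mul] at h1
  rw [div_eq_mul_inv, ← h1]
  refine measureReal_mono fun ω hω => ?_
  obtain ⟨e, he, hωe⟩ := Set.mem_iUnion₂.1 hω
  exact hG e he ω hωe

end RademacherTensor

/-! ### The ratio bound and the main theorem. -/

theorem sosValue_div_polyMax_le {n q : ℕ} (hq4 : 4 ≤ q) (hqn : q ≤ n)
    (e : Fin n × (Fin n × Fin n) → ℤˣ)
    (he : ∀ l, 1 ≤ l → l ≤ q / 2 → ∀ v, |dotProduct ((sliceOperator l e).mulVec v) v| ≤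
      sliceBound n l * dotProduct v v) :
    0 < polyMax (signTensor e).toPoly ∧
      sosValue q (signTensor e).toPoly / ((polyMax (signTensor e).toPoly : ℝ) : EReal) ≤
        ((((8 * 14400000 ^ 2) * n * Real.log n ^ 2 / q) ^ (1 / 4 : ℝ) : ℝ) : EReal) := by
  have hn0 : (0 : ℝ) < n := by exact_mod_cast (by omega : 0 < n)
  have hq0 : (0 : ℝ) < q := by exact_mod_cast (by omega : 0 < q)
  have hg1 := one_le_log_of_four_le (hq4.trans hqn)
  set g := Real.log n with hg
  set M := polyMax (signTensor e).toPoly with hM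
  set z := Real.sqrt n with hz
  have hz0 : 0 < z := Real.sqrt_pos.2 hn0
  have hz2 : z ^ 2 = n := Real.sq_sqrt hn0.le
  have hMz : z ≤ 6 * M := by
    obtain ⟨m, rfl⟩ : ∃ m, n = m + 1 := ⟨n - 1, by omega⟩
    have h1 := sqrt_le_three_mul_polyMax (by omega) e
    have h2 : z ≤ 2 * Real.sqrt m := by
      rw [show (2 : ℝ) * Real.sqrt m = Real.sqrt (4 * m) by
        rw [Real.sqrt_mul (by norm_num), show (4 : ℝ) = 2 ^ 2 by norm_num,
          Real.sqrt_sq (by norm_num)]]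
      apply Real.sqrt_le_sqrt
      push_cast
      have : (1 : ℝ) ≤ m := by exact_mod_cast (by omega : 1 ≤ m)
      linarith
    linarith
  have hM0 : 0 < M := by linarith
  refine ⟨hM0, ?_⟩
  set c : ℝ := ((8 * 14400000 ^ 2) * n * g ^ 2 / q) ^ (1 / 4 : ℝ) with hc
  have hbase : 0 ≤ (8 * 14400000 ^ 2) * n * g ^ 2 / q := by positivity
  have hc0 : 0 ≤ c := Real.rpow_nonneg hbase _
  have hc4 : c ^ 4 = (8 * 14400000 ^ 2) * n * g ^ 2 / q := by
    rw [hc, ← Real.rpow_natCast, ← Real.rpow_mul hbase]; norm_num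
  have hmain : Real.sqrt (16 * (25000 * g * z ^ 3) / Real.sqrt ((q / 2 / 2 : ℕ) : ℝ)) ≤ M * c := by
    set y := Real.sqrt ((q / 2 / 2 : ℕ) : ℝ) with hy
    -- The two roundings in `q / 2 / 2` lose at most a factor `2`, because `q ≥ 4`.
    have hq8 : (q : ℝ) ≤ 8 * ((q / 2 / 2 : ℕ) : ℝ) := by exact_mod_cast (by omega)
    have hy2 : y ^ 2 = ((q / 2 / 2 : ℕ) : ℝ) := Real.sq_sqrt (by positivity)
    have hy0 : 0 < y := Real.sqrt_pos.2 (by linarith)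
    rw [Real.sqrt_le_left (by positivity), div_le_iff₀ hy0]
    have h1 : z ^ 2 * c ^ 2 ≤ 36 * (M * c) ^ 2 := by
      have : z ^ 2 ≤ (6 * M) ^ 2 := by gcongr
      nlinarith [sq_nonneg c]
    -- `14400000 = 36 · 16 · 25000`, with `36` from `z² ≤ (6M)²` and the rest from the bound on the
    -- cubic.
    have h2 : 14400000 * g * z ≤ c ^ 2 * y := by
      apply (sq_le_sq₀ (by positivity) (by positivity)).1
      have e1 : (c ^ 2 * y) ^ 2 = c ^ 4 * y ^ 2 := by ring
      have e2 : (14400000 * g * z) ^ 2 = 14400000 ^ 2 * n * g ^ 2 := by rw [← hz2]; ring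
      rw [e1, e2, hc4, hy2, div_mul_eq_mul_div, le_div_iff₀ hq0]
      have : 0 ≤ 14400000 ^ 2 * n * g ^ 2 := by positivity
      nlinarith
    have h3 : z ^ 2 * (14400000 * g * z) ≤ z ^ 2 * (c ^ 2 * y) := by gcongr
    have h4 : z ^ 2 * c ^ 2 * y ≤ 36 * (M * c) ^ 2 * y := by gcongr
    nlinarith
  rw [EReal.div_le_iff_le_mul (by exact_mod_cast hM0) (EReal.coe_ne_top _)]
  refine sSup_le ?_
  rintro v ⟨E, hf, hE, hS, rfl⟩
  rw [← EReal.coe_mul, EReal.coe_le_coe_iff]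
  obtain ⟨L, hL, hLE⟩ := hE.exists_isPseudoMoment hS
  rw [hLE]
  refine le_trans ?_ hmain
  have := hL.cubic_le (hq4.trans hqn) (by omega) (by omega) e he
  rwa [← toPoly_signTensor] at this

theorem mainTheorem4 :
    ∃ (C : ℝ) (k : ℕ) (c : ℝ), 0 < C ∧ 0 < c ∧
      ∀ (n q : ℕ), Even q → 3 ≤ q → q ≤ n →
        ∀ (Ω : Type*) [MeasurableSpace Ω] (P : Measure Ω) [IsProbabilityMeasure P]
          (A : Ω → RealTensor 3 n), IsRademacherTensor P A →
          1 - (n : ℝ) ^ (-c) ≤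
            P.real {ω | 0 < polyMax (A ω).toPoly ∧
              sosValue q (A ω).toPoly / ((polyMax (A ω).toPoly : ℝ) : EReal) ≤
                (((C * n * Real.log n ^ k / q) ^ (1 / 4 : ℝ) : ℝ) : EReal)} := by
  -- The pseudo-moment bound has `√(log n)`, which is `(log n)²` under the fourth root; the exponent
  -- `c = 1` is the exceptional fraction `1/n`.
  refine ⟨8 * 14400000 ^ 2, 2, 1, by norm_num, one_pos, ?_⟩
  intro n q hq hq3 hqn Ω _ P _ A hA
  -- Parity excludes `q = 3`, so that `N = q / 2 ≥ 2` and the squares of the quadratics `Q_i` are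
  -- within reach.
  have hq4 : 4 ≤ q := by
    obtain ⟨r, rfl⟩ := hq
    omega
  obtain ⟨S, hS, hSb⟩ := exists_finset_sliceOperator_bounded (hq4.trans hqn) (N := q / 2) (by omega)
  rw [Real.rpow_neg_one]
  refine le_trans ?_ (hA.card_div_card_le_measureReal S ?_)
  · rw [le_div_iff₀ (by exact_mod_cast Fintype.card_pos)]
    exact hS
  · intro e he ω hω
    rw [Set.mem_ofPred_eq, hω]
    exact sosValue_div_polyMax_le hq4 hqn e (hSb e he)
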